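/- Let $\mathbb{K}$ be a field. A *finite rigid monoidal category* over $\mathbb{K}$ is a $\mathbb{K}$-linear abelian category with finite-dimensional morphism spaces, in which every object has finite length, which has enough projectives and only finitely many isomorphism classes of simple objects, together with a monoidal structure whose tensor product is $\mathbb{K}$-bilinear on morphisms and in which every object has left and right duals. Let $\mathcal{B}$ and $\mathcal{C}$ be finite rigid monoidal categories over $\mathbb{K}$, let $\mathcal{C}$ be braided with braiding $\beta$, and let $\iota:\mathcal{C}\to\mathcal{B}$ be a fully faithful $\mathbb{K}$-linear monoidal functor, which exhibits $\mathcal{C}$ as a central braided subcategory of $\mathcal{B}$: that is, we are given isomorphisms $c_{X,Y}:X\otimes\iota(Y)\to\iota(Y)\otimes X$ for $X\in\mathcal{B}$, $Y\in\mathcal{C}$, natural in $X$ and $Y$, satisfying the hexagon identities in both arguments, and such that $c_{\iota(Y),Y'}$ is the image under $\iota$ of $\beta_{Y,Y'}$ for all $Y,Y'\in\mathcal{C}$. For a Hopf algebra $H$ in $\mathcal{C}$ (with multiplication, unit, comultiplication $\Delta$, counit $\varepsilon$, antipode, the compatibility being formulated with $\beta$) let ${\rm Rep}(H)(\mathcal{C})$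 be the $\mathbb{K}$-linear monoidal category of left $H$-modules in $\mathcal{C}$. Here $H$ acts on the tensor product $M\otimes N$ formed in $\mathcal{C}$ by applying $\Delta$, then $\beta_{H,M}$, and then the two actions, and $H$ acts on the unit object by $\varepsilon$. Let ${\rm triv}:\mathcal{C}\to{\rm Rep}(H)(\mathcal{C})$ be the monoidal functor that endows an object with the action through $\varepsilon$; the half-braiding of $M\in{\rm Rep}(H)(\mathcal{C})$ and ${\rm triv}(Y)$ is $\beta_{M,Y}$. Then the following are equivalent: 1. There is a faithful exact $\mathbb{K}$-linear monoidal functor $F:\mathcal{B}\to\mathcal{C}$ which is the identity on $\mathcal{C}$, i.e. with $F\circ\iota\cong{\rm id}_{\mathcal{C}}$ as monoidal functors. 2. There are a Hopf algebra $H$ in $\mathcal{C}$ and an equivalence $E:\mathcal{B}\to{\rm Rep}(H)(\mathcal{C})$ of $\mathbb{K}$-linear monoidal categories which is compatible with the inclusions of $\mathcal{C}$, i.e. with $E\circ\iota\cong{\rm triv}$ as monoidal functors. 3. There are $H$, $E$ and a monoidal isomorphism $E\circ\iota\cong{\rm triv}$ as in (2) such that moreover $E$ takes the half-braidings $c_{X,Y}$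 of $\mathcal{B}$ to the half-braidings $\beta_{E(X),Y}$ of ${\rm Rep}(H)(\mathcal{C})$. -/

import Mathlib

open CategoryTheory MonoidalCategory

universe w v₁ v₂ u₁ u₂

section Finite

variable (K : Type w) [Field K] (C : Type u₁) [Category.{v₁} C] [Abelian C] [Linear K C]

/-- A `K`-linear abelian category is *finite* if all its morphism spaces are finite dimensional,
all its objects have finite length, it has enough projectives, and it has only finitely many
simple objects up to isomorphism. -/
class IsFiniteLinearCategory : Prop where
  finite_hom : ∀ X Y : C, Module.Finite K (X ⟶ Y)
  isNoetherianObject : ∀ X : C, IsNoetherianObject X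
  isArtinianObject : ∀ X : C, IsArtinianObject X
  enoughProjectives : EnoughProjectives C
  finite_simples : ∃ (n : ℕ) (S : Fin n → C), ∀ X : C, Simple X → ∃ i, Nonempty (X ≅ S i)

end Finite

section Central

variable {C : Type u₁} [Category.{v₁} C] [MonoidalCategory C] [BraidedCategory C]
  {B : Type u₂} [Category.{v₂} B] [MonoidalCategory B]

open Functor.LaxMonoidal Functor.OplaxMonoidal

/-- A central structure on a monoidal functor `ι : C ⥤ B` out of a braided category (thought of as
an inclusion `C ⊂ B`): half-braidings `c_{X,Y} : X ⊗ Y ≅ Y ⊗ X` for `X` in `B` and `Y` in `C`,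
natural and multiplicative in both arguments, which restrict to the braiding of `C`. -/
structure CentralStructure (ι : C ⥤ B) [ι.Monoidal] where
  /-- The half-braiding. -/
  iso : ∀ (X : B) (Y : C), X ⊗ ι.obj Y ≅ ι.obj Y ⊗ X
  naturality_left : ∀ {X X' : B} (f : X ⟶ X') (Y : C),
    f ▷ ι.obj Y ≫ (iso X' Y).hom = (iso X Y).hom ≫ ι.obj Y ◁ f
  naturality_right : ∀ (X : B) {Y Y' : C} (g : Y ⟶ Y'),
    X ◁ ι.map g ≫ (iso X Y').hom = (iso X Y).hom ≫ ι.map g ▷ X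
  hexagon_left : ∀ (X X' : B) (Y : C),
    (iso (X ⊗ X') Y).hom =
      (α_ X X' (ι.obj Y)).hom ≫ X ◁ (iso X' Y).hom ≫ (α_ X (ι.obj Y) X').inv ≫
        (iso X Y).hom ▷ X' ≫ (α_ (ι.obj Y) X X').hom
  hexagon_right : ∀ (X : B) (Y Y' : C),
    X ◁ μ ι Y Y' ≫ (iso X (Y ⊗ Y')).hom =
      (α_ X (ι.obj Y) (ι.obj Y')).inv ≫ (iso X Y).hom ▷ ι.obj Y' ≫
        (α_ (ι.obj Y) X (ι.obj Y')).hom ≫ ι.obj Y ◁ (iso X Y').hom ≫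
          (α_ (ι.obj Y) (ι.obj Y') X).inv ≫ μ ι Y Y' ▷ X
  braiding : ∀ Y Y' : C,
    (iso (ι.obj Y) Y').hom ≫ μ ι Y' Y = μ ι Y Y' ≫ ι.map (β_ Y Y').hom

/-- Let `B` and `B'` be monoidal categories with central functors `ι : C ⥤ B` and `ι' : C ⥤ B'`.
A monoidal functor `E : B ⥤ B'`, with an identification `θ` of `ι ⋙ E` with `ι'`, *preserves the
half-braidings* if `E` maps the half-braiding of `X` in `B` and `Y` in `C` to the half-braiding of
`E X` and `Y`. -/
def PreservesHalfBraidings {B' : Type*} [Category* B'] [MonoidalCategory B']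
    {ι : C ⥤ B} [ι.Monoidal] {ι' : C ⥤ B'} [ι'.Monoidal]
    (c : CentralStructure ι) (c' : CentralStructure ι')
    (E : B ⥤ B') [E.Monoidal] (θ : ι ⋙ E ≅ ι') : Prop :=
  ∀ (X : B) (Y : C),
    μ E X (ι.obj Y) ≫ E.map (c.iso X Y).hom =
      E.obj X ◁ θ.hom.app Y ≫ (c'.iso (E.obj X) Y).hom ≫ θ.inv.app Y ▷ E.obj X ≫
        μ E (ι.obj Y) X

end Central

/-! ### The monoidal category `Rep(H)(C)` of modules over a bialgebra `H` in `C` -/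

namespace RepCat

open scoped MonObj ComonObj

section Linear

lemma act_hom {C : Type u₁} [Category.{v₁} C] [MonoidalCategory C] {A : C} [MonObj A]
    {M N : Mod C A} (f : M ⟶ N) : γ[A, M.X] ≫ f.hom = A ◁ f.hom ≫ γ[A, N.X] :=
  IsModHom.smul_hom (A := A) (f := f.hom)

variable {C : Type u₁} [Category.{v₁} C] [MonoidalCategory C] [Preadditive C]
  [MonoidalPreadditive C] {A : C} [MonObj A]

/-- The morphisms of `A`-modules `M ⟶ N` form a subgroup of the morphisms `M.X ⟶ N.X`. -/
def homAddSubgroup (M N : Mod C A) : AddSubgroup (M.X ⟶ N.X) where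
  carrier := {f | γ[A, M.X] ≫ f = A ◁ f ≫ γ[A, N.X]}
  zero_mem' := by simp
  add_mem' {f g} hf hg := by
    simp only [Set.mem_ofPred_eq] at hf hg ⊢
    simp [hf, hg]
  neg_mem' {f} hf := by
    have h : A ◁ (-f) = -(A ◁ f) := (tensorLeft A).map_neg
    simp only [Set.mem_ofPred_eq] at hf ⊢
    simp [h, hf]

/-- The bijection between module morphisms and elements of `homAddSubgroup`. -/
def homEquiv (M N : Mod C A) : (M ⟶ N) ≃ homAddSubgroup M N where
  toFun f := ⟨f.hom, act_hom f⟩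
  invFun f := Mod.Hom.mk' f.1 f.2
  left_inv _ := rfl
  right_inv _ := rfl

instance (M N : Mod C A) : AddCommGroup (M ⟶ N) := (homEquiv M N).addCommGroup

@[simp] lemma add_hom {M N : Mod C A} (f g : M ⟶ N) : (f + g).hom = f.hom + g.hom := rfl

instance : Preadditive (Mod C A) where

variable (K : Type w) [Field K] [Linear K C] [MonoidalLinear K C]

instance (M N : Mod C A) : Module K (M ⟶ N) :=
  letI : SMul K (M ⟶ N) := ⟨fun r f => Mod.Hom.mk' (r • f.hom) (by
    have h := act_hom f
    simp only [selfLeftAction_actionHomRight]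
    simp [h])⟩
  Function.Injective.module K
    (f := ({ toFun := fun f => f.hom, map_zero' := rfl, map_add' := fun _ _ => rfl } :
      (M ⟶ N) →+ (M.X ⟶ N.X)))
    (fun _ _ h => Mod.hom_ext _ _ h) (fun _ _ => rfl)

variable {K} in
@[simp] lemma smul_hom {M N : Mod C A} (r : K) (f : M ⟶ N) : (r • f).hom = r • f.hom := rfl

instance : Linear K (Mod C A) where

end Linear

variable {C : Type u₁} [Category.{v₁} C] [MonoidalCategory C] [BraidedCategory C]
  (H : C) [BimonObj H]

/-- The trivial action of `H` on an object of `C`, through the counit. -/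
abbrev trivAct (X : C) : ModObj H X where
  smul := ε[H] ▷ X ≫ (λ_ X).hom
  one_smul := by simp [← comp_whiskerRight_assoc]
  mul_smul := by
    simp only [selfLeftAction_actionHomLeft, selfLeftAction_actionHomRight,
      selfLeftAction_actionAssocIso]
    rw [← comp_whiskerRight_assoc, BimonObj.mul_counit]
    rw [Comon.tensorObj_counit]
    simp [MonoidalCategory.tensorHom_def']

/-- The action of `H` on `M ⊗ N`: comultiply, braid the second copy of `H` past `M`, and act on
both factors. -/
abbrev tensorAct (M N : C) [ModObj H M] [ModObj H N] : ModObj H (M ⊗ N) where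
  smul := Δ[H] ▷ (M ⊗ N) ≫ tensorμ H H M N ≫ (γ[H, M] ⊗ₘ γ[H, N])
  one_smul := by
    have h : η[H] ≫ Δ[H] = (λ_ (𝟙_ C)).inv ≫ (η[H] ⊗ₘ η[H]) := by
      simp [MonObj.tensorObj.one_def]
    simp only [selfLeftAction_actionHomLeft, selfLeftAction_actionUnitIso]
    rw [← comp_whiskerRight_assoc, h, comp_whiskerRight_assoc, tensorμ_natural_left_assoc,
      tensorHom_comp_tensorHom, ModObj.one_smul_self, ModObj.one_smul_self,
      ← tensor_left_unitality]
  mul_smul := by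
    simp only [selfLeftAction_actionHomLeft, selfLeftAction_actionHomRight,
      selfLeftAction_actionAssocIso]
    rw [← comp_whiskerRight_assoc, BimonObj.mul_comul]
    simp only [comp_whiskerRight, Category.assoc, whiskerLeft_comp]
    rw [tensorμ_natural_left_assoc, tensorHom_comp_tensorHom, ModObj.mul_smul_self,
      ModObj.mul_smul_self, ← tensorHom_comp_tensorHom, tensor_associativity_assoc]
    rw [whisker_exchange_assoc, whisker_exchange_assoc]
    rw [tensorμ_natural_right_assoc, tensorHom_comp_tensorHom]
    have h : (Δ[H] ⊗ₘ Δ[H]) ▷ (M ⊗ N) ≫ (α_ (H ⊗ H) (H ⊗ H) (M ⊗ N)).hom =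
        (α_ H H (M ⊗ N)).hom ≫ H ◁ Δ[H] ▷ (M ⊗ N) ≫ Δ[H] ▷ ((H ⊗ H) ⊗ M ⊗ N) := by
      simp only [MonoidalCategory.tensorHom_def']
      monoidal
    rw [reassoc_of% h]


/-- The underlying action of `H` on the tensor product of two modules. -/
lemma tensorAct_smul (M N : C) [ModObj H M] [ModObj H N] :
    (tensorAct H M N).smul = Δ[H] ▷ (M ⊗ N) ≫ tensorμ H H M N ≫ (γ[H, M] ⊗ₘ γ[H, N]) := rfl

variable {H}

lemma tensor_act_hom {M N M' N' : Mod C H} (f : M ⟶ M') (g : N ⟶ N') :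
    (tensorAct H M.X N.X).smul ≫ (f.hom ⊗ₘ g.hom) =
      H ◁ (f.hom ⊗ₘ g.hom) ≫ (tensorAct H M'.X N'.X).smul := by
  simp only [tensorAct_smul, Category.assoc]
  rw [tensorHom_comp_tensorHom, act_hom, act_hom, ← tensorHom_comp_tensorHom,
    ← tensorμ_natural_right_assoc, ← whisker_exchange_assoc]

lemma assoc_act (M N P : Mod C H) :
    letI := tensorAct H M.X N.X
    letI := tensorAct H N.X P.X
    (tensorAct H (M.X ⊗ N.X) P.X).smul ≫ (α_ M.X N.X P.X).hom =
      H ◁ (α_ M.X N.X P.X).hom ≫ (tensorAct H M.X (N.X ⊗ P.X)).smul := by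
  simp only [tensorAct_smul]
  have e₁ : (Δ[H] ▷ (M.X ⊗ N.X) ≫ tensorμ H H M.X N.X ≫ (γ[H, M.X] ⊗ₘ γ[H, N.X]) ⊗ₘ γ[H, P.X]) =
      (Δ[H] ▷ (M.X ⊗ N.X) ⊗ₘ (H ◁ 𝟙 P.X)) ≫ tensorμ H H M.X N.X ▷ (H ⊗ P.X) ≫
        ((γ[H, M.X] ⊗ₘ γ[H, N.X]) ⊗ₘ γ[H, P.X]) := by
    simp [MonoidalCategory.tensorHom_def]
  have e₂ : (γ[H, M.X] ⊗ₘ Δ[H] ▷ (N.X ⊗ P.X) ≫ tensorμ H H N.X P.X ≫ (γ[H, N.X] ⊗ₘ γ[H, P.X])) =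
      ((H ◁ 𝟙 M.X) ⊗ₘ Δ[H] ▷ (N.X ⊗ P.X)) ≫ (H ⊗ M.X) ◁ tensorμ H H N.X P.X ≫
        (γ[H, M.X] ⊗ₘ (γ[H, N.X] ⊗ₘ γ[H, P.X])) := by
    simp [MonoidalCategory.tensorHom_def']
  have n₁ := tensorμ_natural_left Δ[H] (𝟙 H) (M.X ⊗ N.X) P.X
  have n₂ := tensorμ_natural_left (𝟙 H) Δ[H] M.X (N.X ⊗ P.X)
  simp only [id_whiskerRight, whiskerLeft_id, tensorHom_id, id_tensorHom] at e₁ e₂ n₁ n₂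
  rw [e₁, e₂]
  simp only [Category.assoc]
  rw [← reassoc_of% n₁, ← reassoc_of% n₂, associator_naturality, associator_monoidal_assoc,
    ← comp_whiskerRight_assoc, ← comp_whiskerRight_assoc, ComonObj.comul_assoc,
    whisker_exchange_assoc, MonoidalCategory.tensorHom_def (α_ H H H).hom]
  simp only [comp_whiskerRight, Category.assoc]

/-- The action on a tensor product whose left factor has the trivial action. -/
lemma tensorAct_triv_left (X M : C) [ModObj H M] :
    letI := trivAct H X
    (tensorAct H X M).smul =
      (α_ H X M).inv ≫ (β_ H X).hom ▷ M ≫ (α_ X H M).hom ≫ X ◁ γ[H, M] := by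
  let := trivAct H X
  have n := tensorμ_natural_left ε[H] (𝟙 H) X M
  have e : (γ[H, X] ⊗ₘ γ[H, M]) =
      (ε[H] ▷ X ⊗ₘ 𝟙 H ▷ M) ≫ ((λ_ X).hom ⊗ₘ γ[H, M]) := by
    rw [tensorHom_comp_tensorHom, id_whiskerRight, Category.id_comp]
    rfl
  rw [tensorAct_smul, e, ← reassoc_of% n, tensorHom_id, ← comp_whiskerRight_assoc,
    ComonObj.counit_comul, MonoidalCategory.tensorHom_def]
  simp only [tensorμ]
  monoidal

/-- The action on a tensor product whose right factor has the trivial action. -/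
lemma tensorAct_triv_right (M Y : C) [ModObj H M] :
    letI := trivAct H Y
    (tensorAct H M Y).smul = (α_ H M Y).inv ≫ γ[H, M] ▷ Y := by
  let := trivAct H Y
  have n := tensorμ_natural_left (𝟙 H) ε[H] M Y
  have e : (γ[H, M] ⊗ₘ γ[H, Y]) =
      (𝟙 H ▷ M ⊗ₘ ε[H] ▷ Y) ≫ (γ[H, M] ⊗ₘ (λ_ Y).hom) := by
    rw [tensorHom_comp_tensorHom, id_whiskerRight, Category.id_comp]
    rfl
  rw [tensorAct_smul, e, ← reassoc_of% n, id_tensorHom, ← comp_whiskerRight_assoc,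
    ComonObj.comul_counit, MonoidalCategory.tensorHom_def']
  simp only [tensorμ, braiding_tensorUnit_left]
  monoidal

lemma leftUnitor_act (M : Mod C H) :
    letI := trivAct H (𝟙_ C)
    (tensorAct H (𝟙_ C) M.X).smul ≫ (λ_ M.X).hom = H ◁ (λ_ M.X).hom ≫ γ[H, M.X] := by
  simp [tensorAct_triv_left, braiding_tensorUnit_right]

lemma rightUnitor_act (M : Mod C H) :
    letI := trivAct H (𝟙_ C)
    (tensorAct H M.X (𝟙_ C)).smul ≫ (ρ_ M.X).hom = H ◁ (ρ_ M.X).hom ≫ γ[H, M.X] := by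
  simp [tensorAct_triv_right]

lemma triv_act_hom {X Y : C} (f : X ⟶ Y) :
    (trivAct H X).smul ≫ f = H ◁ f ≫ (trivAct H Y).smul := by
  change (ε[H] ▷ X ≫ (λ_ X).hom) ≫ f = H ◁ f ≫ ε[H] ▷ Y ≫ (λ_ Y).hom
  rw [whisker_exchange_assoc]
  simp

lemma tensorAct_triv_triv (X Y : C) :
    letI := trivAct H X
    letI := trivAct H Y
    (tensorAct H X Y).smul = (trivAct H (X ⊗ Y)).smul := by
  let := trivAct H X
  rw [tensorAct_triv_right]
  change (α_ H X Y).inv ≫ (ε[H] ▷ X ≫ (λ_ X).hom) ▷ Y = ε[H] ▷ (X ⊗ Y) ≫ (λ_ (X ⊗ Y)).hom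
  monoidal

/-- The braiding with an object carrying the trivial action is a morphism of modules. -/
lemma braiding_act (M Y : C) [ModObj H M] :
    letI := trivAct H Y
    (tensorAct H M Y).smul ≫ (β_ M Y).hom = H ◁ (β_ M Y).hom ≫ (tensorAct H Y M).smul := by
  rw [tensorAct_triv_right, tensorAct_triv_left, Category.assoc,
    BraidedCategory.braiding_naturality_left]
  simp

/-- An isomorphism of the underlying objects which commutes with the actions. -/
@[simps]
def mkIso {M N : Mod C H} (e : M.X ≅ N.X) (h : γ[H, M.X] ≫ e.hom = H ◁ e.hom ≫ γ[H, N.X]) :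
    M ≅ N where
  hom := Mod.Hom.mk' e.hom h
  inv := Mod.Hom.mk' e.inv (by
    have h' : γ[H, N.X] ≫ e.inv = H ◁ e.inv ≫ γ[H, M.X] := by
      rw [Iso.comp_inv_eq, Category.assoc, h, whiskerLeft_inv_hom_assoc]
    exact h')
  hom_inv_id := by ext; simp
  inv_hom_id := by ext; simp

instance : MonoidalCategoryStruct (Mod C H) where
  tensorObj M N := letI := tensorAct H M.X N.X; ⟨M.X ⊗ N.X⟩
  tensorUnit := letI := trivAct H (𝟙_ C); ⟨𝟙_ C⟩
  tensorHom f g := Mod.Hom.mk' (f.hom ⊗ₘ g.hom) (tensor_act_hom f g)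
  whiskerLeft M _ _ g := Mod.Hom.mk' (M.X ◁ g.hom) (by simpa using tensor_act_hom (𝟙 M) g)
  whiskerRight f N := Mod.Hom.mk' (f.hom ▷ N.X) (by simpa using tensor_act_hom f (𝟙 N))
  associator M N P := mkIso (α_ M.X N.X P.X) (assoc_act M N P)
  leftUnitor M := mkIso (λ_ M.X) (leftUnitor_act M)
  rightUnitor M := mkIso (ρ_ M.X) (rightUnitor_act M)

instance : (Mod.forget (D := C) H).Faithful where
  map_injective h := Mod.hom_ext _ _ h

/-- The forgetful functor strictly preserves all the monoidal operations. -/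
def inducingData : Monoidal.InducingFunctorData (Mod.forget (D := C) H) where
  μIso _ _ := Iso.refl _
  εIso := Iso.refl _
  whiskerLeft_eq M _ _ g := by
    change M.X ◁ g.hom = 𝟙 _ ≫ M.X ◁ g.hom ≫ 𝟙 _
    simp
  whiskerRight_eq f N := by
    change f.hom ▷ N.X = 𝟙 _ ≫ f.hom ▷ N.X ≫ 𝟙 _
    simp
  tensorHom_eq f g := by
    change (f.hom ⊗ₘ g.hom) = 𝟙 _ ≫ (f.hom ⊗ₘ g.hom) ≫ 𝟙 _
    simp
  associator_eq M N P := by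
    change (α_ M.X N.X P.X).hom =
      (𝟙 _ ≫ (𝟙 (M.X ⊗ N.X) ⊗ₘ 𝟙 P.X)) ≫ (α_ M.X N.X P.X).hom ≫
        (𝟙 M.X ⊗ₘ 𝟙 (N.X ⊗ P.X)) ≫ 𝟙 _
    simp
  leftUnitor_eq M := by
    change (λ_ M.X).hom = (𝟙 _ ≫ (𝟙 (𝟙_ C) ⊗ₘ 𝟙 M.X)) ≫ (λ_ M.X).hom
    simp
  rightUnitor_eq M := by
    change (ρ_ M.X).hom = (𝟙 _ ≫ (𝟙 M.X ⊗ₘ 𝟙 (𝟙_ C))) ≫ (ρ_ M.X).hom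
    simp

/-- The monoidal category `Rep(H)(C)`: the tensor product is that of `C`, with the action above. -/
instance : MonoidalCategory (Mod C H) := Monoidal.induced _ inducingData

instance : (Mod.forget (D := C) H).Monoidal := Monoidal.fromInducedMonoidal _ inducingData

variable (H)

/-- The inclusion `C ⥤ Rep(H)(C)`, which endows an object of `C` with the trivial action. -/
def triv : C ⥤ Mod C H where
  obj X := letI := trivAct H X; ⟨X⟩
  map {X Y} f :=
    letI := trivAct H X; letI := trivAct H Y
    Mod.Hom.mk'' f (triv_act_hom f)

/-- The inclusion `C ⥤ Rep(H)(C)` is a strict monoidal functor. -/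
instance : (triv H).Monoidal :=
  Functor.CoreMonoidal.toMonoidal
    { εIso := Iso.refl _
      μIso := fun X Y => mkIso (M := (triv H).obj X ⊗ (triv H).obj Y) (N := (triv H).obj (X ⊗ Y))
        (Iso.refl (X ⊗ Y)) (by
          change (letI := trivAct H X; letI := trivAct H Y; (tensorAct H X Y).smul) ≫ 𝟙 _ =
            H ◁ 𝟙 _ ≫ (trivAct H (X ⊗ Y)).smul
          rw [tensorAct_triv_triv]
          simp)
      μIso_hom_natural_left := fun {X Y} f Z => by
        ext
        change f ▷ Z ≫ 𝟙 _ = 𝟙 _ ≫ f ▷ Z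
        simp
      μIso_hom_natural_right := fun {X Y} Z f => by
        ext
        change Z ◁ f ≫ 𝟙 _ = 𝟙 _ ≫ Z ◁ f
        simp
      associativity := fun X Y Z => by
        ext
        change 𝟙 (X ⊗ Y) ▷ Z ≫ 𝟙 _ ≫ (α_ X Y Z).hom = (α_ X Y Z).hom ≫ X ◁ 𝟙 (Y ⊗ Z) ≫ 𝟙 _
        simp
      left_unitality := fun X => by
        ext
        change (λ_ X).hom = 𝟙 (𝟙_ C) ▷ X ≫ 𝟙 _ ≫ (λ_ X).hom
        simp
      right_unitality := fun X => by
        ext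
        change (ρ_ X).hom = X ◁ 𝟙 (𝟙_ C) ≫ 𝟙 _ ≫ (ρ_ X).hom
        simp }

/-- The central structure of `C ⊂ Rep(H)(C)`: the half-braiding of a module `M` and an object `Y`
of `C` (with trivial action) is the braiding of `C` on the underlying objects. -/
def trivCentral : CentralStructure (triv H) where
  iso M Y := mkIso (M := M ⊗ (triv H).obj Y) (N := (triv H).obj Y ⊗ M)
    (β_ M.X Y) (braiding_act M.X Y)
  naturality_left f Y := by
    ext
    exact BraidedCategory.braiding_naturality_left f.hom Y
  naturality_right M _ _ g := by
    ext
    exact BraidedCategory.braiding_naturality_right M.X g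
  hexagon_left M N Y := by
    ext
    exact BraidedCategory.braiding_tensor_left_hom M.X N.X Y
  hexagon_right M Y Z := by
    ext
    change M.X ◁ 𝟙 (Y ⊗ Z) ≫ (β_ M.X (Y ⊗ Z)).hom =
      (α_ M.X Y Z).inv ≫ (β_ M.X Y).hom ▷ Z ≫ (α_ Y M.X Z).hom ≫ Y ◁ (β_ M.X Z).hom ≫
        (α_ Y Z M.X).inv ≫ 𝟙 (Y ⊗ Z) ▷ M.X
    simp
  braiding Y Z := by
    ext
    change (β_ Y Z).hom ≫ 𝟙 _ = 𝟙 _ ≫ (β_ Y Z).hom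
    simp

end RepCat

/-! The implication from 3 to 2 forgets data. From 2 to 1, compose the equivalence with the
forgetful functor `Mod.forget H`. It has a left adjoint (free modules `H ⊗ Y`) and, since `H` has a
left dual, a right adjoint (cofree modules `ᘁH ⊗ Y`), so it is exact.

The substance is 1 to 3, a Tannaka reconstruction relative to `C`. The given `F` need not send the
half-braidings `c` to the braiding: it only transports `c` to some half-braiding `half` of each `F
X` with the objects of `C`. The monoidal structure of `F` is therefore replaced by `μ` precomposed
with the discrepancy `β ≫ half⁻¹`. The functor does not change, `half` equals `β` on objects coming
from `C`, so the retraction onto `C` stays monoidal, and the twisted functor does send `c` to `β`.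

By finiteness and left exactness the functor `X ↦ Hom(𝟙, F X)` is represented by some `U` with a
universal point `pt : 𝟙 ⟶ F U` (`exists_universal_point`). Duality in `B` upgrades this to `Hom(U ⊗
X, Z) ≅ Hom(F X, F Z)`; with `X = ι Y`, the functor `Y ↦ U ⊗ ι Y` is left adjoint to `F`. As `F (U ⊗
ι Y) ≅ F U ⊗ Y`, the resulting monad is tensoring with the algebra `F U`, and faithfulness and
exactness identify `B` with its modules.

The coalgebra structure on `U` makes `pt` grouplike, and `F` carries it to `F U`. The action on `F
(X ⊗ X')` is computed through `Δ` and the braiding because `F` sends `c` to `β` (`μ_act`); this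
gives the bialgebra axioms and a monoidal comparison functor. The antipode comes from `coev : U ⊗ X
⟶ ι (F X)`, which corresponds to the identity of `F X`, as does `ev : U ⊗ ι (F X) ⟶ X`; the two are
convolution inverse to each other. -/

section Finite

/-! ### Coseparators and representability of left exact functors on finite categories -/

open Limits

variable (K : Type w) [Field K]

attribute [local instance] Abelian.hasFiniteBiproducts

/-- A finite linear category has a projective separator. -/
theorem exists_projective_isSeparator (B : Type u₂) [Category.{v₂} B] [Abelian B] [Linear K B]
    [IsFiniteLinearCategory K B] : ∃ P : B, Projective P ∧ IsSeparator P := by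
  have : EnoughProjectives B := IsFiniteLinearCategory.enoughProjectives K
  obtain ⟨n, S, hS⟩ := IsFiniteLinearCategory.finite_simples (K := K) (C := B)
  -- A nonzero Artinian object contains a simple subobject, and every simple object is a quotient of
  -- a summand of the biproduct.
  have hne : ∀ X : B, ¬ IsZero X → ∃ g : (⨁ fun i => Projective.over (S i)) ⟶ X, g ≠ 0 := by
    intro X hX
    have : IsArtinianObject X := IsFiniteLinearCategory.isArtinianObject K X
    obtain ⟨i, ⟨e⟩⟩ := hS (simpleSubobject hX) inferInstance
    refine ⟨biproduct.π _ i ≫ Projective.π (S i) ≫ e.inv ≫ simpleSubobjectArrow hX, fun h => ?_⟩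
    rw [← comp_zero (f := biproduct.π _ i), cancel_epi,
      ← comp_zero (f := Projective.π (S i)), cancel_epi, ← comp_zero (f := e.inv), cancel_epi] at h
    exact Simple.not_isZero (simpleSubobject hX) (IsZero.of_mono_eq_zero _ h)
  have hproj : Projective (⨁ fun i => Projective.over (S i)) :=
    ⟨fun f e _ => ⟨biproduct.desc fun i => Projective.factorThru
      (biproduct.ι (fun i => Projective.over (S i)) i ≫ f) e, by cat_disch⟩⟩
  refine ⟨⨁ fun i => Projective.over (S i), hproj,
    (Preadditive.isSeparator_iff _).2 fun X Y f hf => ?_⟩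
  by_contra h0
  -- A nonzero map to the image of `f` lifts to `X` by projectivity, and the lift is killed by `f`.
  obtain ⟨g, hg⟩ := hne (Abelian.image f) fun hz => h0 (by
    rw [← Abelian.image.fac f, hz.eq_zero_of_src (Abelian.image.ι f), comp_zero])
  apply hg
  rw [← cancel_mono (Abelian.image.ι f), zero_comp,
    ← Projective.factorThru_comp g (Abelian.factorThruImage f), Category.assoc,
    Abelian.image.fac, hf]

/-- The right dual of a separator is a coseparator. -/
theorem isCoseparator_rightDual {B : Type u₂} [Category.{v₂} B] [Abelian B] [MonoidalCategory B]
    [MonoidalPreadditive B] [RigidCategory B] {P : B} (hP : IsSeparator P) :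
    IsCoseparator (Pᘁ) := by
  rw [Preadditive.isSeparator_iff] at hP
  refine (Preadditive.isCoseparator_iff _).2 fun X Y f hf => ?_
  -- Both `Hom(Y, Pᘁ)` and `Hom(P, ᘁY)` are `Hom(Y ⊗ P, 𝟙)`. So the hypothesis on `f` says that
  -- every map from `P` is killed by the left dual of `f`, which vanishes since `P` separates.
  have h1 : ∀ t : Y ⊗ P ⟶ 𝟙_ B, f ▷ P ≫ t = 0 := fun t => by
    have h := hf (tensorRightHomEquiv Y P (Pᘁ) (𝟙_ B) t ≫ (λ_ _).hom)
    rw [← Category.assoc, ← cancel_mono (λ_ (Pᘁ)).inv] at h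
    simp only [Category.assoc, Iso.hom_inv_id, Category.comp_id, zero_comp] at h
    have h' := congrArg (tensorRightHomEquiv X P (Pᘁ) (𝟙_ B)).symm h
    rw [tensorRightHomEquiv_symm_naturality, Equiv.symm_apply_apply] at h'
    rw [h']
    simp [tensorRightHomEquiv]
  have h2 : (ᘁf) = 0 := by
    refine hP _ fun s => ?_
    rw [← cancel_mono (ρ_ (ᘁX)).inv, zero_comp, Category.assoc]
    apply (tensorLeftHomEquiv P (ᘁX) X (𝟙_ B)).symm.injective
    rw [tensorLeftHomEquiv_symm_naturality, ← tensorLeftHomEquiv_whiskerRight_comp_evaluation,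
      Equiv.symm_apply_apply, whisker_exchange_assoc, h1]
    simp [tensorLeftHomEquiv]
  have h3 : f ▷ (ᘁY : B) ≫ ε_ (ᘁY : B) Y = 0 := by
    apply (tensorLeftHomEquiv (ᘁY) (ᘁX) X (𝟙_ B)).injective
    rw [tensorLeftHomEquiv_whiskerRight_comp_evaluation, h2]
    simp [tensorLeftHomEquiv]
  rw [← cancel_mono (λ_ Y).inv, zero_comp]
  -- `(ᘁY)ᘁ` unfolds to `Y`, so `f` is recovered by transposing the zero pairing `h3`.
  have h4 := tensorRightHomEquiv_whiskerRight_comp_evaluation (X := ᘁY) (Y := X)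
    (show X ⟶ (ᘁY)ᘁ from f)
  refine h4.symm.trans ?_
  refine (congrArg (tensorRightHomEquiv X (ᘁY) Y (𝟙_ B)) h3).trans ?_
  simp [tensorRightHomEquiv]

/-- Every generalized point of a functor factors through a minimal subobject. -/
theorem exists_minimal_factorization {B : Type u₂} [Category.{v₂} B]
    {C : Type u₁} [Category.{v₁} C] (F : B ⥤ C) (Y : C) (X : B) [IsArtinianObject X]
    (x : Y ⟶ F.obj X) :
    ∃ (N : B) (i : N ⟶ X) (q : Y ⟶ F.obj N), Mono i ∧ q ≫ F.map i = x ∧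
      ∀ (M : B) (j : M ⟶ N) (r : Y ⟶ F.obj M), Mono j → r ≫ F.map j = q → IsIso j := by
  obtain ⟨N, ⟨q, hq⟩, hN⟩ := WellFounded.has_min
    (IsWellFounded.wf : WellFounded ((· < ·) : Subobject X → Subobject X → Prop))
    {N | ∃ q : Y ⟶ F.obj (N : B), q ≫ F.map N.arrow = x} ⟨⊤, x ≫ F.map (inv (⊤ : Subobject X).arrow),
      by rw [Category.assoc, ← F.map_comp, IsIso.inv_hom_id]; simp⟩
  refine ⟨N, N.arrow, q, inferInstance, hq, fun M j r hj hr => ?_⟩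
  have hle : Subobject.mk (j ≫ N.arrow) ≤ N := Subobject.mk_le_of_comm j rfl
  have hnl := hN (Subobject.mk (j ≫ N.arrow)) ⟨r ≫ F.map (Subobject.underlyingIso _).inv, by
    rw [Category.assoc, ← F.map_comp, Subobject.underlyingIso_arrow, F.map_comp, reassoc_of% hr,
      hq]⟩
  have heq : Subobject.mk (j ≫ N.arrow) = N := hle.eq_of_not_lt hnl
  have : j = (Subobject.isoOfMkEq (j ≫ N.arrow) N heq).hom := by
    rw [← cancel_mono N.arrow]
    simp
  rw [this]
  infer_instance

/-- A linear left exact functor out of a category with a coseparator has a universal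
generalized point. -/
theorem exists_universal_point {B : Type u₂} [Category.{v₂} B] [Abelian B] [Linear K B]
    {C : Type u₁} [Category.{v₁} C] [Abelian C] [Linear K C]
    (hB : ∀ X : B, IsArtinianObject X) {Q : B} (hQ : IsCoseparator Q)
    (F : B ⥤ C) [F.Additive] [F.Linear K] [PreservesFiniteLimits F] (Y : C)
    (hfin : ∀ X : B, Module.Finite K (X ⟶ Q)) (hfin' : Module.Finite K (Y ⟶ F.obj Q)) :
    ∃ (U : B) (u : Y ⟶ F.obj U), ∀ (X : B) (t : Y ⟶ F.obj X), ∃! f : U ⟶ X, u ≫ F.map f = t := by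
  let b := Module.finBasis K (Y ⟶ F.obj Q)
  -- The components of `q₀` are a basis of `Hom(Y, F Q)`, so every map from `Y` to a power of `F Q`
  -- is `q₀` followed by `F` of a scalar matrix. A minimal subobject supporting `q₀` is the
  -- representing object.
  let q₀ : Y ⟶ F.obj (⨁ fun _ : Fin (Module.finrank K (Y ⟶ F.obj Q)) => Q) :=
    ∑ i, b i ≫ F.map (biproduct.ι (fun _ => Q) i)
  have hq₀ : ∀ i, q₀ ≫ F.map (biproduct.π (fun _ => Q) i) = b i := fun i => by
    rw [Preadditive.sum_comp, Finset.sum_eq_single i]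
    · simp [← F.map_comp]
    · intro j _ hj
      simp [← F.map_comp, biproduct.ι_π_ne _ hj]
    · simp
  obtain ⟨U, i, u, hi, hu, hmin⟩ := exists_minimal_factorization F Y _ q₀
  refine ⟨U, u, fun X t => existsUnique_of_exists_of_unique ?_ ?_⟩
  · let g := Module.finBasis K (X ⟶ Q)
    -- A basis of `Hom(X, Q)` is jointly monic because `Q` is a coseparator.
    let J : X ⟶ ⨁ fun _ : Fin (Module.finrank K (X ⟶ Q)) => Q := biproduct.lift fun j => g j
    have hJ : Mono J := by
      refine Preadditive.mono_of_cancel_zero _ fun {Z} h hh => ?_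
      refine (Preadditive.isCoseparator_iff _).1 hQ _ fun k => ?_
      have hg : ∀ j, h ≫ g j = 0 := fun j => by
        have := hh =≫ biproduct.π (fun _ => Q) j
        simpa [J] using this
      rw [← g.sum_repr k, Preadditive.comp_sum]
      simp [hg]
    let A : (⨁ fun _ : Fin (Module.finrank K (Y ⟶ F.obj Q)) => Q) ⟶
        ⨁ fun _ : Fin (Module.finrank K (X ⟶ Q)) => Q :=
      biproduct.lift fun j => ∑ i, b.repr (t ≫ F.map (g j)) i • biproduct.π (fun _ => Q) i
    have hA : q₀ ≫ F.map A = t ≫ F.map J := by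
      have key : ∀ z z' : Y ⟶ F.obj (⨁ fun _ : Fin (Module.finrank K (X ⟶ Q)) => Q),
          (∀ j, z ≫ F.map (biproduct.π (fun _ => Q) j) =
            z' ≫ F.map (biproduct.π (fun _ => Q) j)) → z = z' := by
        intro z z' h
        rw [← Category.comp_id z, ← Category.comp_id z', ← F.map_id, ← biproduct.total,
          F.map_sum, Preadditive.comp_sum, Preadditive.comp_sum]
        refine Finset.sum_congr rfl fun j _ => ?_
        rw [F.map_comp, reassoc_of% h j]
      refine key _ _ fun j => ?_
      rw [Category.assoc, Category.assoc, ← F.map_comp, ← F.map_comp, biproduct.lift_π,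
        biproduct.lift_π, F.map_sum, Preadditive.comp_sum]
      conv_rhs => rw [← b.sum_repr (t ≫ F.map (g j))]
      refine Finset.sum_congr rfl fun i _ => ?_
      rw [F.map_smul, Linear.comp_smul, hq₀]
    -- The part of `U` that `i ≫ A` maps into `X` is a subobject through which `u` factors, as `F`
    -- preserves the pullback. By minimality it is all of `U`, which yields the map to `X`.
    have sq := (IsPullback.of_hasPullback (i ≫ A) J).map F
    have hw : u ≫ F.map (i ≫ A) = t ≫ F.map J := by
      rw [F.map_comp, reassoc_of% hu, hA]
    have := hmin _ (pullback.fst (i ≫ A) J) (sq.lift u t hw) inferInstance (sq.lift_fst _ _ _)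
    refine ⟨inv (pullback.fst (i ≫ A) J) ≫ pullback.snd (i ≫ A) J, ?_⟩
    have h1 : u ≫ F.map (inv (pullback.fst (i ≫ A) J)) = sq.lift u t hw := by
      rw [← cancel_mono (F.map (pullback.fst (i ≫ A) J)), sq.lift_fst, Category.assoc,
        ← F.map_comp]
      simp
    rw [F.map_comp, reassoc_of% h1, sq.lift_snd]
  · intro f f' hf hf'
    -- The equalizer of two solutions also supports `u`, hence is all of `U`.
    have hl := isLimitForkMapOfIsLimit F _ (equalizerIsEqualizer f f')
    have := hmin _ (equalizer.ι f f') (Fork.IsLimit.lift hl u (hf.trans hf'.symm)) inferInstance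
      (Fork.IsLimit.lift_ι' hl _ _)
    exact eq_of_epi_equalizer

end Finite

/-! ### Free and cofree modules: exactness of the forgetful functor -/

section Forget

open Limits
open scoped MonObj

variable {C : Type u₁} [Category.{v₁} C] [MonoidalCategory C] (A : C) [MonObj A]

/-- The free module on an object. -/
abbrev freeModObj (Y : C) : ModObj A (A ⊗ Y) where
  smul := (α_ A A Y).inv ≫ μ[A] ▷ Y
  one_smul := by
    simp only [selfLeftAction_actionHomLeft, selfLeftAction_actionUnitIso]
    rw [associator_inv_naturality_left_assoc, ← comp_whiskerRight, MonObj.one_mul]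
    simp
  mul_smul := by
    simp only [selfLeftAction_actionHomLeft, selfLeftAction_actionHomRight,
      selfLeftAction_actionAssocIso]
    rw [associator_inv_naturality_left_assoc, ← comp_whiskerRight, MonObj.mul_assoc]
    simp only [comp_whiskerRight, MonoidalCategory.whiskerLeft_comp, Category.assoc]
    rw [associator_inv_naturality_middle_assoc]
    monoidal

/-- The universal property of the free module. -/
def freeModHomEquiv (Y : C) (M : Mod C A) :
    ((letI := freeModObj A Y; ⟨A ⊗ Y⟩ : Mod C A) ⟶ M) ≃ (Y ⟶ M.X) where
  toFun f := (λ_ Y).inv ≫ η[A] ▷ Y ≫ f.hom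
  invFun g := Mod.Hom.mk' (M := (letI := freeModObj A Y; ⟨A ⊗ Y⟩ : Mod C A)) (A ◁ g ≫ γ[A, M.X]) (by
    change ((α_ A A Y).inv ≫ μ[A] ▷ Y) ≫ A ◁ g ≫ γ[A, M.X] = A ◁ (A ◁ g ≫ γ[A, M.X]) ≫ γ[A, M.X]
    rw [Category.assoc, ← whisker_exchange_assoc, ModObj.mul_smul_self]
    simp)
  left_inv f := by
    ext
    have h := RepCat.act_hom f
    change ((α_ A A Y).inv ≫ μ[A] ▷ Y) ≫ f.hom = _ at h
    change A ◁ ((λ_ Y).inv ≫ η[A] ▷ Y ≫ f.hom) ≫ γ[A, M.X] = f.hom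
    simp only [MonoidalCategory.whiskerLeft_comp, Category.assoc, ← h]
    rw [associator_inv_naturality_middle_assoc, ← comp_whiskerRight_assoc, MonObj.mul_one]
    simp
  right_inv g := by
    change (λ_ Y).inv ≫ η[A] ▷ Y ≫ A ◁ g ≫ γ[A, M.X] = g
    rw [← whisker_exchange_assoc, ModObj.one_smul_self]
    simp

instance : (Mod.forget (D := C) A).IsRightAdjoint :=
  (Adjunction.adjunctionOfEquivLeft (G := Mod.forget (D := C) A) (freeModHomEquiv A)
    (fun X Y Y' g h => by
      change (λ_ X).inv ≫ η[A] ▷ X ≫ h.hom ≫ g.hom = ((λ_ X).inv ≫ η[A] ▷ X ≫ h.hom) ≫ g.hom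
      simp)).isRightAdjoint

section Cofree

variable {A : C} [HasLeftDual A]

variable (A) in
/-- The evaluation of the internal hom out of `A`. -/
def ihomEval (Y : C) : A ⊗ ((ᘁA) ⊗ Y) ⟶ Y :=
  (α_ _ _ _).inv ≫ ε_ (ᘁA) A ▷ Y ≫ (λ_ Y).hom

/-- Uniqueness of currying. The identities for the cofree module are all checked after evaluation.
-/
lemma ihomEval_ext {X Y : C} {f g : X ⟶ (ᘁA) ⊗ Y}
    (h : A ◁ f ≫ ihomEval A Y = A ◁ g ≫ ihomEval A Y) : f = g :=
  (tensorLeftHomEquiv X (ᘁA) A Y).symm.injective h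

/-- The morphism into the internal hom out of `A` given by currying. -/
def ihomCurry {X Y : C} (t : A ⊗ X ⟶ Y) : X ⟶ (ᘁA) ⊗ Y :=
  tensorLeftHomEquiv X (ᘁA) A Y t

lemma ihomCurry_fac {X Y : C} (t : A ⊗ X ⟶ Y) : A ◁ ihomCurry t ≫ ihomEval A Y = t :=
  (tensorLeftHomEquiv X (ᘁA) A Y).symm_apply_apply t

end Cofree

variable [HasLeftDual A]

/-- The cofree module on an object. -/
abbrev cofreeModObj (Y : C) : ModObj A ((ᘁA) ⊗ Y) where
  smul := ihomCurry ((α_ A A _).inv ≫ μ[A] ▷ _ ≫ ihomEval A Y)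
  one_smul := by
    apply ihomEval_ext
    simp only [selfLeftAction_actionHomLeft, selfLeftAction_actionUnitIso]
    rw [MonoidalCategory.whiskerLeft_comp, Category.assoc, ihomCurry_fac,
      associator_inv_naturality_middle_assoc, ← comp_whiskerRight_assoc, MonObj.mul_one]
    monoidal
  mul_smul := by
    apply ihomEval_ext
    change A ◁ (μ[A] ▷ ((ᘁA) ⊗ Y) ≫ ihomCurry _) ≫ _ =
      A ◁ ((α_ A A ((ᘁA) ⊗ Y)).hom ≫ A ◁ ihomCurry _ ≫ ihomCurry _) ≫ _
    simp only [MonoidalCategory.whiskerLeft_comp, Category.assoc, ihomCurry_fac]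
    rw [associator_inv_naturality_right_assoc, whisker_exchange_assoc, ihomCurry_fac,
      associator_inv_naturality_middle_assoc, ← comp_whiskerRight_assoc, MonObj.mul_assoc_flip,
      comp_whiskerRight_assoc, comp_whiskerRight_assoc]
    monoidal

/-- The universal property of the cofree module. -/
def cofreeModHomEquiv (M : Mod C A) (Y : C) :
    (M.X ⟶ Y) ≃ (M ⟶ (letI := cofreeModObj A Y; ⟨(ᘁA) ⊗ Y⟩ : Mod C A)) where
  toFun g := Mod.Hom.mk' (N := (letI := cofreeModObj A Y; ⟨(ᘁA) ⊗ Y⟩ : Mod C A))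
    (ihomCurry (γ[A, M.X] ≫ g)) (by
      apply ihomEval_ext
      change A ◁ (γ[A, M.X] ≫ ihomCurry (γ[A, M.X] ≫ g)) ≫ ihomEval A Y =
        A ◁ (A ◁ ihomCurry (γ[A, M.X] ≫ g) ≫
          ihomCurry ((α_ A A _).inv ≫ μ[A] ▷ _ ≫ ihomEval A Y)) ≫ ihomEval A Y
      simp only [MonoidalCategory.whiskerLeft_comp, Category.assoc, ihomCurry_fac]
      rw [associator_inv_naturality_right_assoc, whisker_exchange_assoc, ihomCurry_fac,
        ModObj.mul_smul_self_assoc, Iso.inv_hom_id_assoc])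
  invFun f := (λ_ M.X).inv ≫ η[A] ▷ M.X ≫ A ◁ f.hom ≫ ihomEval A Y
  left_inv g := by
    change (λ_ M.X).inv ≫ η[A] ▷ M.X ≫ A ◁ (ihomCurry (γ[A, M.X] ≫ g)) ≫ ihomEval A Y = g
    rw [ihomCurry_fac, ModObj.one_smul_self_assoc]
    simp
  right_inv f := by
    ext
    apply ihomEval_ext
    have h := RepCat.act_hom f
    change γ[A, M.X] ≫ f.hom =
      A ◁ f.hom ≫ ihomCurry ((α_ A A _).inv ≫ μ[A] ▷ _ ≫ ihomEval A Y) at h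
    change A ◁ ihomCurry (γ[A, M.X] ≫ (λ_ M.X).inv ≫ η[A] ▷ M.X ≫ A ◁ f.hom ≫ ihomEval A Y) ≫
      ihomEval A Y = _
    rw [ihomCurry_fac, ← whisker_exchange_assoc, ← leftUnitor_inv_naturality_assoc, reassoc_of% h,
      leftUnitor_inv_naturality_assoc, whisker_exchange_assoc, ihomCurry_fac,
      associator_inv_naturality_left_assoc, ← comp_whiskerRight_assoc, MonObj.one_mul]
    monoidal

instance : (Mod.forget (D := C) A).IsLeftAdjoint :=
  (Adjunction.adjunctionOfEquivRight (F := Mod.forget (D := C) A) (cofreeModHomEquiv A)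
    (fun X X' Y' f g => by
      ext
      apply ihomEval_ext
      change A ◁ ihomCurry (γ[A, X.X] ≫ f.hom ≫ g) ≫ ihomEval A Y' =
        A ◁ (f.hom ≫ ihomCurry (γ[A, X'.X] ≫ g)) ≫ ihomEval A Y'
      simp only [MonoidalCategory.whiskerLeft_comp, Category.assoc, ihomCurry_fac]
      have h (t : X'.X ⟶ Y') : γ[A, X.X] ≫ f.hom ≫ t = A ◁ f.hom ≫ γ[A, X'.X] ≫ t := by
        rw [reassoc_of% (RepCat.act_hom f)]
      exact h g)).isLeftAdjoint

end Forget

/-! ### From an equivalence with modules to a fiber functor -/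

section Forget

open Limits

/-- Forgetting a trivial action. -/
def trivForgetIso {C : Type u₁} [Category.{v₁} C] [MonoidalCategory C] [BraidedCategory C]
    (H : C) [BimonObj H] : RepCat.triv H ⋙ Mod.forget H ≅ 𝟭 C :=
  NatIso.ofComponents (fun _ => Iso.refl _)
    fun f => (Category.comp_id f).trans (Category.id_comp f).symm

instance {C : Type u₁} [Category.{v₁} C] [MonoidalCategory C] [BraidedCategory C]
    (H : C) [BimonObj H] : NatTrans.IsMonoidal (trivForgetIso H).hom where
  unit := by
    change (𝟙 (𝟙_ C) ≫ 𝟙 (𝟙_ C)) ≫ 𝟙 (𝟙_ C) = 𝟙 (𝟙_ C)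
    simp
  tensor X Y := by
    change (𝟙 (X ⊗ Y) ≫ 𝟙 (X ⊗ Y)) ≫ 𝟙 (X ⊗ Y) = (𝟙 X ⊗ₘ 𝟙 Y) ≫ 𝟙 (X ⊗ Y)
    simp

/-- The forgetful functor from `Rep(H)(C)` composed with an equivalence is a fiber functor. -/
theorem exists_fiberFunctor_of_equivalence (K : Type w) [Field K]
    {C : Type u₁} [Category.{v₁} C] [Preadditive C] [Linear K C] [MonoidalCategory C]
    [MonoidalPreadditive C] [MonoidalLinear K C] [RigidCategory C] [BraidedCategory C]
    {B : Type u₂} [Category.{v₂} B] [Preadditive B] [Linear K B] [MonoidalCategory B]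
    (ι : C ⥤ B) [ι.Monoidal] (H : C) [HopfObj H] (E : B ≌ CategoryTheory.Mod C H)
    [E.functor.Monoidal] [E.functor.Additive] [E.functor.Linear K]
    (θ : ι ⋙ E.functor ≅ RepCat.triv H) [NatTrans.IsMonoidal θ.hom] :
    ∃ (F : B ⥤ C) (_ : F.Monoidal),
        F.Additive ∧ F.Linear K ∧ F.Faithful ∧
        Limits.PreservesFiniteLimits F ∧ Limits.PreservesFiniteColimits F ∧
        ∃ θ : ι ⋙ F ≅ 𝟭 C, NatTrans.IsMonoidal θ.hom := by
  refine ⟨E.functor ⋙ Mod.forget H, inferInstance, ⟨?_⟩, ⟨?_⟩, inferInstance, ?_, ?_,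
    (Functor.associator _ _ _).symm ≪≫ Functor.isoWhiskerRight θ (Mod.forget H) ≪≫
      trivForgetIso H, ?_⟩
  · intro X Y f g
    exact congrArg Mod.Hom.hom E.functor.map_add
  · intro X Y f r
    exact congrArg Mod.Hom.hom (E.functor.map_smul r f)
  · have : PreservesFiniteLimits (Mod.forget (D := C) H) := inferInstance
    exact comp_preservesFiniteLimits _ _
  · have : PreservesFiniteColimits (Mod.forget (D := C) H) := inferInstance
    exact comp_preservesFiniteColimits _ _
  · dsimp only [Iso.trans_hom, Functor.isoWhiskerRight_hom, Iso.symm_hom]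
    infer_instance

end Forget

/-! ### Monoidal retractions onto `C` -/

section FiberIso

open Functor.LaxMonoidal Functor.OplaxMonoidal Functor.Monoidal

variable {C : Type u₁} [Category.{v₁} C] {B : Type u₂} [Category.{v₂} B] {ι : C ⥤ B} {F : B ⥤ C}
  (θ : ι ⋙ F ≅ 𝟭 C)

/-- The components of a natural isomorphism which retracts `F` onto `C`. -/
def fiberIso (Y : C) : F.obj (ι.obj Y) ≅ Y := θ.app Y

lemma map_fiberIso_hom {Y Y' : C} (g : Y ⟶ Y') :
    F.map (ι.map g) ≫ (fiberIso θ Y').hom = (fiberIso θ Y).hom ≫ g := θ.hom.naturality g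

lemma fiberIso_inv_map {Y Y' : C} (g : Y ⟶ Y') :
    (fiberIso θ Y).inv ≫ F.map (ι.map g) = g ≫ (fiberIso θ Y').inv := (θ.inv.naturality g).symm

variable [MonoidalCategory C] [MonoidalCategory B] [ι.Monoidal] [F.Monoidal]
  [NatTrans.IsMonoidal θ.hom]

lemma unit_fiberIso_hom : ε F ≫ F.map (ε ι) ≫ (fiberIso θ (𝟙_ C)).hom = 𝟙 _ := by
  simpa [fiberIso] using NatTrans.IsMonoidal.unit (τ := θ.hom)

lemma tensor_fiberIso_hom (Y Y' : C) :
    μ F (ι.obj Y) (ι.obj Y') ≫ F.map (μ ι Y Y') ≫ (fiberIso θ (Y ⊗ Y')).hom =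
      ((fiberIso θ Y).hom ⊗ₘ (fiberIso θ Y').hom) := by
  have h := NatTrans.IsMonoidal.tensor (τ := θ.hom) Y Y'
  simp only [comp_μ, id_μ, Category.assoc] at h
  exact h.trans (Category.comp_id _)

lemma tensor_fiberIso_inv (Y Y' : C) :
    ((fiberIso θ Y).inv ⊗ₘ (fiberIso θ Y').inv) ≫ μ F (ι.obj Y) (ι.obj Y') ≫ F.map (μ ι Y Y') =
      (fiberIso θ (Y ⊗ Y')).inv := by
  rw [← cancel_mono (fiberIso θ (Y ⊗ Y')).hom, Category.assoc, Category.assoc,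
    tensor_fiberIso_hom, tensorHom_comp_tensorHom]
  simp

lemma fiberIso_inv_tensor (Y Y' : C) :
    (fiberIso θ (Y ⊗ Y')).inv ≫ F.map (δ ι Y Y') ≫ δ F (ι.obj Y) (ι.obj Y') =
      ((fiberIso θ Y).inv ⊗ₘ (fiberIso θ Y').inv) := by
  rw [← tensor_fiberIso_inv]
  simp

end FiberIso

/-! ### Transported half-braidings and the twisted fiber functor -/

namespace CentralStructure

open Functor.LaxMonoidal Functor.OplaxMonoidal Functor.Monoidal

variable {C : Type u₁} [Category.{v₁} C] [MonoidalCategory C] [BraidedCategory C]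
  {B : Type u₂} [Category.{v₂} B] [MonoidalCategory B] {ι : C ⥤ B} [ι.Monoidal]
  (c : CentralStructure ι) {F : B ⥤ C} [F.Monoidal] (θ : ι ⋙ F ≅ 𝟭 C)

/-- The half-braiding on the objects `F X` induced by a central structure. -/
def half (X : B) (Y : C) : F.obj X ⊗ Y ≅ Y ⊗ F.obj X :=
  whiskerLeftIso (F.obj X) (fiberIso θ Y).symm ≪≫ μIso F X (ι.obj Y) ≪≫ F.mapIso (c.iso X Y) ≪≫
    (μIso F (ι.obj Y) X).symm ≪≫ whiskerRightIso (fiberIso θ Y) (F.obj X)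

lemma half_hom (X : B) (Y : C) : (c.half θ X Y).hom =
    F.obj X ◁ (fiberIso θ Y).inv ≫ μ F X (ι.obj Y) ≫ F.map (c.iso X Y).hom ≫ δ F (ι.obj Y) X ≫
      (fiberIso θ Y).hom ▷ F.obj X := rfl

lemma half_naturality_left {X X' : B} (f : X ⟶ X') (Y : C) :
    F.map f ▷ Y ≫ (c.half θ X' Y).hom = (c.half θ X Y).hom ≫ Y ◁ F.map f := by
  simp only [half_hom, Category.assoc]
  rw [← whisker_exchange_assoc, μ_natural_left_assoc, ← F.map_comp_assoc, c.naturality_left,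
    F.map_comp_assoc, ← whisker_exchange, ← δ_natural_right_assoc]

lemma half_naturality_right (X : B) {Y Y' : C} (g : Y ⟶ Y') :
    F.obj X ◁ g ≫ (c.half θ X Y').hom = (c.half θ X Y).hom ≫ g ▷ F.obj X := by
  simp only [half_hom, Category.assoc]
  rw [← whiskerLeft_comp_assoc, ← fiberIso_inv_map, whiskerLeft_comp_assoc,
    μ_natural_right_assoc, ← F.map_comp_assoc, c.naturality_right, F.map_comp_assoc,
    ← δ_natural_left_assoc, ← comp_whiskerRight, ← comp_whiskerRight, map_fiberIso_hom]

lemma half_tensor_left (X X' : B) (Y : C) :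
    μ F X X' ▷ Y ≫ (c.half θ (X ⊗ X') Y).hom =
      (α_ _ _ _).hom ≫ F.obj X ◁ (c.half θ X' Y).hom ≫ (α_ _ _ _).inv ≫
        (c.half θ X Y).hom ▷ F.obj X' ≫ (α_ _ _ _).hom ≫ Y ◁ μ F X X' := by
  have e : (c.half θ X' Y).hom = F.obj X' ◁ (fiberIso θ Y).inv ≫ (μ F X' (ι.obj Y) ≫
      F.map (c.iso X' Y).hom ≫ δ F (ι.obj Y) X') ≫ (fiberIso θ Y).hom ▷ F.obj X' := by
    simp [half_hom]
  have e' : (c.half θ X Y).hom = F.obj X ◁ (fiberIso θ Y).inv ≫ (μ F X (ι.obj Y) ≫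
      F.map (c.iso X Y).hom ≫ δ F (ι.obj Y) X) ≫ (fiberIso θ Y).hom ▷ F.obj X := by
    simp [half_hom]
  -- The hexagon pushed through `F`, before identifying `F (ι Y)` with `Y`. The identifications
  -- inserted between the two factors cancel by `hc`.
  have key : μ F X X' ▷ F.obj (ι.obj Y) ≫ μ F (X ⊗ X') (ι.obj Y) ≫
      F.map (c.iso (X ⊗ X') Y).hom ≫ δ F (ι.obj Y) (X ⊗ X') =
      (α_ _ _ _).hom ≫ F.obj X ◁ (μ F X' (ι.obj Y) ≫
        F.map (c.iso X' Y).hom ≫ δ F (ι.obj Y) X') ≫ (α_ _ _ _).inv ≫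
        (μ F X (ι.obj Y) ≫ F.map (c.iso X Y).hom ≫ δ F (ι.obj Y) X) ▷ F.obj X' ≫
        (α_ _ _ _).hom ≫ F.obj (ι.obj Y) ◁ μ F X X' := by
    rw [c.hexagon_left]
    simp only [Functor.map_comp, map_associator, map_associator_inv, map_whiskerLeft,
      map_whiskerRight, Category.assoc, whiskerLeft_comp, comp_whiskerRight, μ_δ_assoc,
      whiskerRight_μ_δ_assoc, μ_δ, Category.comp_id]
  generalize μ F X' (ι.obj Y) ≫ F.map (c.iso X' Y).hom ≫ δ F (ι.obj Y) X' = f' at e key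
  generalize μ F X (ι.obj Y) ≫ F.map (c.iso X Y).hom ≫ δ F (ι.obj Y) X = f at e' key
  have hc : F.obj X ◁ (fiberIso θ Y).hom ▷ F.obj X' ≫ (α_ _ _ _).inv ≫
      (F.obj X ◁ (fiberIso θ Y).inv) ▷ F.obj X' = (α_ _ _ _).inv := by
    simp [← whiskerLeft_comp_assoc, ← comp_whiskerRight]
  rw [e, e', half_hom, ← whisker_exchange_assoc]
  simp only [comp_whiskerRight, whiskerLeft_comp, Category.assoc] at key ⊢
  rw [reassoc_of% key, reassoc_of% hc, whisker_exchange]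
  monoidal

lemma half_tensor_right [NatTrans.IsMonoidal θ.hom] (X : B) (Y Y' : C) :
    (c.half θ X (Y ⊗ Y')).hom =
      (α_ _ _ _).inv ≫ (c.half θ X Y).hom ▷ Y' ≫ (α_ _ _ _).hom ≫ Y ◁ (c.half θ X Y').hom ≫
        (α_ _ _ _).inv := by
  have e : (c.half θ X Y').hom = F.obj X ◁ (fiberIso θ Y').inv ≫ (μ F X (ι.obj Y') ≫
      F.map (c.iso X Y').hom ≫ δ F (ι.obj Y') X) ≫ (fiberIso θ Y').hom ▷ F.obj X := by
    simp [half_hom]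
  have e' : (c.half θ X Y).hom = F.obj X ◁ (fiberIso θ Y).inv ≫ (μ F X (ι.obj Y) ≫
      F.map (c.iso X Y).hom ≫ δ F (ι.obj Y) X) ≫ (fiberIso θ Y).hom ▷ F.obj X := by
    simp [half_hom]
  have key : F.obj X ◁ (μ F (ι.obj Y) (ι.obj Y') ≫ F.map (μ ι Y Y')) ≫ μ F X (ι.obj (Y ⊗ Y')) ≫
      F.map (c.iso X (Y ⊗ Y')).hom =
      (α_ _ _ _).inv ≫ (μ F X (ι.obj Y) ≫ F.map (c.iso X Y).hom ≫ δ F (ι.obj Y) X) ▷ _ ≫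
        (α_ _ _ _).hom ≫ F.obj (ι.obj Y) ◁ (μ F X (ι.obj Y') ≫
        F.map (c.iso X Y').hom ≫ δ F (ι.obj Y') X) ≫ (α_ _ _ _).inv ≫
        (μ F (ι.obj Y) (ι.obj Y') ≫ F.map (μ ι Y Y')) ▷ _ ≫ μ F (ι.obj (Y ⊗ Y')) X := by
    have h := congrArg F.map (c.hexagon_right X Y Y')
    simp only [Functor.map_comp, map_associator, map_associator_inv, map_whiskerLeft,
      map_whiskerRight, Category.assoc] at h
    rw [whiskerLeft_comp, Category.assoc]
    rw [← cancel_epi (F.obj X ◁ δ F (ι.obj Y) (ι.obj Y')), ← cancel_epi (δ F X _)]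
    simp only [whiskerLeft_δ_μ_assoc]
    rw [h]
    simp only [comp_whiskerRight, whiskerLeft_comp, Category.assoc, μ_δ_assoc]
  generalize μ F X (ι.obj Y') ≫ F.map (c.iso X Y').hom ≫ δ F (ι.obj Y') X = f' at e key
  generalize μ F X (ι.obj Y) ≫ F.map (c.iso X Y).hom ≫ δ F (ι.obj Y) X = f at e' key
  rw [e, e', half_hom, ← tensor_fiberIso_inv, whiskerLeft_comp_assoc, reassoc_of% key, μ_δ_assoc,
    ← comp_whiskerRight, Category.assoc, tensor_fiberIso_hom]
  have h₁ (G : F.obj X ⊗ Y' ⟶ Y' ⊗ F.obj X) :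
      (fiberIso θ Y).hom ▷ F.obj X ▷ Y' ≫ (α_ _ _ _).hom ≫ Y ◁ G =
        (α_ _ _ _).hom ≫ _ ◁ G ≫ (fiberIso θ Y).hom ▷ (Y' ⊗ F.obj X) := by
    rw [associator_naturality_left_assoc, ← whisker_exchange]
  have h₂ : F.obj X ◁ _ ◁ (fiberIso θ Y').inv ≫ (α_ _ _ _).inv ≫ f ▷ _ =
      (α_ _ _ _).inv ≫ f ▷ Y' ≫ _ ◁ (fiberIso θ Y').inv := by
    rw [associator_inv_naturality_right_assoc, whisker_exchange]
  rw [MonoidalCategory.tensorHom_def, MonoidalCategory.tensorHom_def']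
  simp only [comp_whiskerRight, Category.assoc]
  rw [reassoc_of% (h₁ _), whiskerLeft_comp _ (_ ▷ _), Category.assoc, reassoc_of% h₂]
  monoidal

/-- On the image of `ι` the half-braiding `c` is the image of `β`, and `θ` is monoidal and natural,
so applying `F` gives back `β`. This is what keeps the retraction monoidal after twisting. -/
lemma half_fiber [NatTrans.IsMonoidal θ.hom] (Y : C) (Z : C) :
    c.half θ (ι.obj Y) Z = β_ (F.obj (ι.obj Y)) Z := by
  ext
  have h : F.map (c.iso (ι.obj Y) Z).hom =
      F.map (μ ι Y Z) ≫ F.map (ι.map (β_ Y Z).hom) ≫ F.map (δ ι Z Y) := by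
    rw [← F.map_comp, ← F.map_comp, ← reassoc_of% c.braiding Y Z]
    simp
  have h₁ : F.obj (ι.obj Y) ◁ (fiberIso θ Z).inv ≫ μ F _ _ ≫ F.map (μ ι Y Z) =
      (fiberIso θ Y).hom ▷ Z ≫ (fiberIso θ (Y ⊗ Z)).inv := by
    rw [← tensor_fiberIso_inv, MonoidalCategory.tensorHom_def]
    simp
  have h₂ : (fiberIso θ (Z ⊗ Y)).inv ≫ F.map (δ ι Z Y) ≫ δ F _ _ ≫ (fiberIso θ Z).hom ▷ _ =
      Z ◁ (fiberIso θ Y).inv := by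
    rw [reassoc_of% @fiberIso_inv_tensor, MonoidalCategory.tensorHom_def']
    simp
  rw [half_hom, h, Category.assoc, Category.assoc, reassoc_of% h₁, reassoc_of% @fiberIso_inv_map, h₂]
  simp

lemma half_unit [NatTrans.IsMonoidal θ.hom] (Z : C) :
    c.half θ (𝟙_ B) Z = β_ (F.obj (𝟙_ B)) Z := by
  ext
  rw [← cancel_mono (Z ◁ F.map (ε ι)), ← half_naturality_left, half_fiber,
    BraidedCategory.braiding_naturality_left]

/-- The second hexagon with both objects equal to the unit says that the half-braiding is its own
square up to unitors; being invertible, it is trivial. -/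
lemma half_unit_right [NatTrans.IsMonoidal θ.hom] (X : B) :
    (c.half θ X (𝟙_ C)).hom = (ρ_ (F.obj X)).hom ≫ (λ_ (F.obj X)).inv := by
  have h := c.half_naturality_right θ X (λ_ (𝟙_ C)).hom
  rw [half_tensor_right] at h
  have h' : F.obj X ◁ (λ_ (𝟙_ C)).hom = (α_ _ _ _).inv ≫ (c.half θ X (𝟙_ C)).hom ▷ 𝟙_ C ≫
      (λ_ (F.obj X)).hom ▷ 𝟙_ C := by
    rw [← cancel_mono (c.half θ X (𝟙_ C)).hom, h]
    simp only [Category.assoc]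
    monoidal
  rw [Iso.eq_comp_inv, ← whiskerRight_iff, comp_whiskerRight,
    ← cancel_epi (α_ _ _ _).inv, ← h']
  monoidal

lemma half_inv_naturality_left {X X' : B} (f : X ⟶ X') (Y : C) :
    Y ◁ F.map f ≫ (c.half θ X' Y).inv = (c.half θ X Y).inv ≫ F.map f ▷ Y := by
  rw [Iso.eq_inv_comp, ← reassoc_of% @half_naturality_left, Iso.hom_inv_id, Category.comp_id]

lemma half_inv_naturality_right (X : B) {Y Y' : C} (g : Y ⟶ Y') :
    g ▷ F.obj X ≫ (c.half θ X Y').inv = (c.half θ X Y).inv ≫ F.obj X ◁ g := by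
  rw [Iso.eq_inv_comp, ← reassoc_of% @half_naturality_right, Iso.hom_inv_id, Category.comp_id]

lemma half_inv_tensor_left (X X' : B) (Y : C) :
    Y ◁ μ F X X' ≫ (c.half θ (X ⊗ X') Y).inv =
      (α_ _ _ _).inv ≫ (c.half θ X Y).inv ▷ F.obj X' ≫ (α_ _ _ _).hom ≫
        F.obj X ◁ (c.half θ X' Y).inv ≫ (α_ _ _ _).inv ≫ μ F X X' ▷ Y := by
  rw [Iso.comp_inv_eq]
  simp only [Category.assoc, half_tensor_left, Iso.inv_hom_id_assoc, whiskerLeft_inv_hom_assoc,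
    Iso.hom_inv_id_assoc, inv_hom_whiskerRight_assoc]

lemma half_inv_tensor_right [NatTrans.IsMonoidal θ.hom] (X : B) (Y Y' : C) :
    (c.half θ X (Y ⊗ Y')).inv =
      (α_ _ _ _).hom ≫ Y ◁ (c.half θ X Y').inv ≫ (α_ _ _ _).inv ≫ (c.half θ X Y).inv ▷ Y' ≫
        (α_ _ _ _).hom := by
  rw [← cancel_epi (c.half θ X (Y ⊗ Y')).hom, Iso.hom_inv_id, half_tensor_right]
  simp

/-- The fiber functor, with its monoidal structure twisted by the half-braidings. -/
@[nolint unusedArguments]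
def twist (_ : CentralStructure ι) (_ : ι ⋙ F ≅ 𝟭 C) : B ⥤ C := F

variable [NatTrans.IsMonoidal θ.hom]

/-- Associativity reduces to the hexagons for `half` and for `β`, naturality of both, and the
Yang–Baxter equation for `β`. Unitality holds because both half-braidings are trivial against the
unit. -/
instance : (c.twist θ).Monoidal :=
  Functor.CoreMonoidal.toMonoidal (F := F)
    { εIso := εIso F
      μIso := fun X X' => β_ (F.obj X) (F.obj X') ≪≫ (c.half θ X (F.obj X')).symm ≪≫ μIso F X X'
      μIso_hom_natural_left := fun f X' => by
        simp only [Iso.trans_hom, Iso.symm_hom, Category.assoc, μIso_hom]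
        rw [BraidedCategory.braiding_naturality_left_assoc, reassoc_of% @half_inv_naturality_left,
          μ_natural_left]
      μIso_hom_natural_right := fun X' f => by
        simp only [Iso.trans_hom, Iso.symm_hom, Category.assoc, μIso_hom]
        rw [BraidedCategory.braiding_naturality_right_assoc, reassoc_of% @half_inv_naturality_right,
          μ_natural_right]
      associativity := fun X Y Z => by
        simp only [Iso.trans_hom, Iso.symm_hom, Category.assoc, μIso_hom]
        rw [BraidedCategory.braiding_naturality_left_assoc]
        simp only [whiskerLeft_comp, Category.assoc]
        rw [reassoc_of% @half_inv_tensor_left, μ_whiskerRight_comp_μ_assoc, ← F.map_comp,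
          BraidedCategory.braiding_naturality_right_assoc,
          BraidedCategory.braiding_naturality_right_assoc,
          BraidedCategory.braiding_naturality_right_assoc, reassoc_of% @half_inv_naturality_right,
          reassoc_of% @half_inv_naturality_right, reassoc_of% @half_inv_tensor_right]
        simp
        rw [← BraidedCategory.yang_baxter_assoc, Iso.hom_inv_id_assoc]
      left_unitality := fun X => by
        simp only [Iso.trans_hom, Iso.symm_hom, Category.assoc, μIso_hom, εIso_hom]
        rw [half_unit]
        simp
      right_unitality := fun X => by
        simp only [Iso.trans_hom, Iso.symm_hom, Category.assoc, μIso_hom, εIso_hom]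
        rw [BraidedCategory.braiding_naturality_right_assoc, reassoc_of% @half_inv_naturality_right]
        have h : (c.half θ X (𝟙_ C)).inv = (λ_ (F.obj X)).hom ≫ (ρ_ (F.obj X)).inv := by
          rw [← cancel_epi (c.half θ X (𝟙_ C)).hom, Iso.hom_inv_id, half_unit_right]
          simp
        rw [h]
        simp }

lemma twist_μ (X X' : B) : μ (c.twist θ) X X' =
    (β_ (F.obj X) (F.obj X')).hom ≫ (c.half θ X (F.obj X')).inv ≫ μ F X X' := rfl

lemma twist_μ_fiber (Y : C) (X : B) : μ (c.twist θ) (ι.obj Y) X = μ F (ι.obj Y) X := by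
  rw [twist_μ, half_fiber]
  exact Iso.hom_inv_id_assoc _ _

/-- The retraction onto `C` for the twisted monoidal structure. -/
def twistIso : ι ⋙ c.twist θ ≅ 𝟭 C := θ

instance : NatTrans.IsMonoidal (c.twistIso θ).hom where
  unit := NatTrans.IsMonoidal.unit (τ := θ.hom)
  tensor X Y := by
    refine Eq.trans ?_ (NatTrans.IsMonoidal.tensor (τ := θ.hom) X Y)
    rw [comp_μ, comp_μ, twist_μ_fiber]
    rfl

/-- The factor `half⁻¹` in the twisted `μ` cancels the half-braiding produced by `F.map (c.iso X
Y).hom`, so only `β` remains. -/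
lemma twist_map_iso (X : B) (Y : C) :
    μ (c.twist θ) X (ι.obj Y) ≫ (c.twist θ).map (c.iso X Y).hom =
      (c.twist θ).obj X ◁ (fiberIso (c.twistIso θ) Y).hom ≫ (β_ ((c.twist θ).obj X) Y).hom ≫
        (fiberIso (c.twistIso θ) Y).inv ▷ (c.twist θ).obj X ≫ μ (c.twist θ) (ι.obj Y) X := by
  rw [twist_μ_fiber, twist_μ]
  change ((β_ (F.obj X) (F.obj (ι.obj Y))).hom ≫ (c.half θ X (F.obj (ι.obj Y))).inv ≫ μ F X (ι.obj Y)) ≫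
    F.map (c.iso X Y).hom = F.obj X ◁ (fiberIso θ Y).hom ≫ (β_ (F.obj X) Y).hom ≫
      (fiberIso θ Y).inv ▷ F.obj X ≫ μ F (ι.obj Y) X
  have h : μ F X (ι.obj Y) ≫ F.map (c.iso X Y).hom =
      (c.half θ X (F.obj (ι.obj Y))).hom ≫ μ F (ι.obj Y) X := by
    rw [← cancel_mono (δ F (ι.obj Y) X), ← cancel_mono ((fiberIso θ Y).hom ▷ F.obj X)]
    simp only [Category.assoc]
    rw [μ_δ_assoc, ← half_naturality_right, half_hom, ← whiskerLeft_comp_assoc]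
    simp
  simp [h]

end CentralStructure

/-! ### Universal points and duality -/

section UniversalPoint

open Functor.LaxMonoidal Functor.OplaxMonoidal Functor.Monoidal

variable {C : Type u₁} [Category.{v₁} C] [MonoidalCategory C]
  {B : Type u₂} [Category.{v₂} B] [MonoidalCategory B]

/-- Monoidal functors preserve exact pairings. -/
abbrev mapExactPairing (F : B ⥤ C) [F.Monoidal] (X Y : B) [ExactPairing X Y] :
    ExactPairing (F.obj X) (F.obj Y) where
  coevaluation' := ε F ≫ F.map (η_ X Y) ≫ δ F X Y
  evaluation' := μ F Y X ≫ F.map (ε_ X Y) ≫ η F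
  coevaluation_evaluation' := by
    have h := congrArg F.map (ExactPairing.coevaluation_evaluation X Y)
    simp only [Functor.map_comp, map_whiskerLeft, map_whiskerRight, map_associator_inv,
      map_rightUnitor, map_leftUnitor_inv, Category.assoc, μ_δ_assoc] at h
    rw [cancel_epi] at h
    have h' := F.obj Y ◁ ε F ≫= h =≫ (δ F (𝟙_ B) Y ≫ η F ▷ F.obj Y)
    simpa only [Category.assoc, μ_δ_assoc, whiskerRight_ε_η, Category.comp_id,
      whiskerLeft_ε_η_assoc, whiskerLeft_comp, comp_whiskerRight] using h'
  evaluation_coevaluation' := by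
    have h := congrArg F.map (ExactPairing.evaluation_coevaluation X Y)
    simp only [Functor.map_comp, map_whiskerLeft, map_whiskerRight, map_associator,
      map_rightUnitor_inv, map_leftUnitor, Category.assoc, μ_δ_assoc] at h
    rw [cancel_epi] at h
    have h' := ε F ▷ F.obj X ≫= h =≫ (δ F X (𝟙_ B) ≫ F.obj X ◁ η F)
    simpa only [Category.assoc, μ_δ_assoc, whiskerLeft_ε_η, Category.comp_id,
      whiskerRight_ε_η_assoc, whiskerLeft_comp, comp_whiskerRight] using h'

/-- A universal generalized point of a functor with shape the unit object. -/
structure UniversalPoint (F : B ⥤ C) where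
  /-- The representing object. -/
  obj : B
  /-- The universal point. -/
  pt : 𝟙_ C ⟶ F.obj obj
  existsUnique : ∀ (X : B) (t : 𝟙_ C ⟶ F.obj X), ∃! f : obj ⟶ X, pt ≫ F.map f = t

namespace UniversalPoint

variable {F : B ⥤ C} (U : UniversalPoint F)

omit [MonoidalCategory B] in
lemma hom_ext {X : B} {f g : U.obj ⟶ X} (h : U.pt ≫ F.map f = U.pt ≫ F.map g) : f = g :=
  (U.existsUnique X _).unique h rfl

variable [F.Monoidal]

/-- Since `F` preserves exact pairings, transposing in `B` and then evaluating at the point agrees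
with evaluating and then transposing in `C`. Thus the universal property of `U` at `Z ⊗ X'` becomes
one of `U ⊗ X` at `Z`. -/
lemma pt_map_tensorRightHomEquiv {X X' Z : B} [ExactPairing X X'] (f : U.obj ⊗ X ⟶ Z) :
    letI := mapExactPairing F X X'
    U.pt ≫ F.map (tensorRightHomEquiv U.obj X X' Z f) =
      tensorRightHomEquiv _ (F.obj X) (F.obj X') (F.obj Z) (U.pt ▷ F.obj X ≫ μ F _ _ ≫ F.map f) ≫
        μ F Z X' := by
  let := mapExactPairing F X X'
  simp only [tensorRightHomEquiv, Equiv.coe_fn_mk, Functor.map_comp, map_whiskerLeft,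
    map_whiskerRight, map_associator_inv, map_rightUnitor_inv, Category.assoc, μ_δ_assoc]
  have h : η_ (F.obj X) (F.obj X') = ε F ≫ F.map (η_ X X') ≫ δ F X X' := rfl
  rw [h, rightUnitor_inv_naturality_assoc, ← whisker_exchange_assoc, ← whisker_exchange_assoc,
    ← whisker_exchange_assoc]
  simp only [whiskerLeft_comp, comp_whiskerRight, Category.assoc,
    associator_inv_naturality_left_assoc]

variable [RightRigidCategory B]

lemma tensor_hom_ext {X Z : B} {f g : U.obj ⊗ X ⟶ Z}
    (h : U.pt ▷ F.obj X ≫ μ F _ _ ≫ F.map f = U.pt ▷ F.obj X ≫ μ F _ _ ≫ F.map g) : f = g := by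
  apply (tensorRightHomEquiv U.obj X (Xᘁ) Z).injective
  apply U.hom_ext
  rw [pt_map_tensorRightHomEquiv, pt_map_tensorRightHomEquiv, h]

/-- Together with `tensor_hom_ext`: `Hom(U ⊗ X, Z) = Hom(U, Z ⊗ Xᘁ) = Hom(𝟙, F Z ⊗ F (Xᘁ)) = Hom(F
X, F Z)`. -/
lemma exists_desc {X Z : B} (t : F.obj X ⟶ F.obj Z) :
    ∃ f : U.obj ⊗ X ⟶ Z, U.pt ▷ F.obj X ≫ μ F _ _ ≫ F.map f = (λ_ _).hom ≫ t := by
  let := mapExactPairing F X (Xᘁ)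
  obtain ⟨g, hg⟩ := (U.existsUnique _ (tensorRightHomEquiv _ (F.obj X) (F.obj (Xᘁ)) (F.obj Z)
    ((λ_ _).hom ≫ t) ≫ μ F Z (Xᘁ))).exists
  refine ⟨(tensorRightHomEquiv U.obj X (Xᘁ) Z).symm g, ?_⟩
  apply (tensorRightHomEquiv _ (F.obj X) (F.obj (Xᘁ)) (F.obj Z)).injective
  rw [← cancel_mono (μ F Z (Xᘁ)), ← hg, ← pt_map_tensorRightHomEquiv, Equiv.apply_symm_apply]

/-- The morphism out of `U ⊗ X` which corresponds to a morphism out of `F X`. -/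
noncomputable def desc {X Z : B} (t : F.obj X ⟶ F.obj Z) : U.obj ⊗ X ⟶ Z :=
  (U.exists_desc t).choose

lemma pt_desc {X Z : B} (t : F.obj X ⟶ F.obj Z) :
    U.pt ▷ F.obj X ≫ μ F _ _ ≫ F.map (U.desc t) = (λ_ _).hom ≫ t :=
  (U.exists_desc t).choose_spec

lemma desc_naturality {X X' Z Z' : B} (t : F.obj X ⟶ F.obj Z) (t' : F.obj X' ⟶ F.obj Z')
    (f : X ⟶ X') (g : Z ⟶ Z') (h : t ≫ F.map g = F.map f ≫ t') :
    U.desc t ≫ g = U.obj ◁ f ≫ U.desc t' := by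
  apply U.tensor_hom_ext
  rw [F.map_comp, reassoc_of% @pt_desc, h, F.map_comp, ← μ_natural_right_assoc,
    ← whisker_exchange_assoc, pt_desc, leftUnitor_naturality_assoc]

end UniversalPoint

end UniversalPoint

/-! ### The comonoid `U` and the action of `F U` on fibers -/

namespace UniversalPoint

open Functor.LaxMonoidal Functor.OplaxMonoidal Functor.Monoidal

variable {C : Type u₁} [Category.{v₁} C] [MonoidalCategory C]
  {B : Type u₂} [Category.{v₂} B] [MonoidalCategory B]
  {F : B ⥤ C} [F.Monoidal] (U : UniversalPoint F)

section Comonoid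

omit [F.Monoidal] in
lemma tensorHom_μ_map_whiskerRight (F : B ⥤ C) [F.LaxMonoidal] {P Q : C} {X Y X' : B}
    (p : P ⟶ F.obj X) (q : Q ⟶ F.obj Y) (f : X ⟶ X') :
    (p ⊗ₘ q) ≫ μ F X Y ≫ F.map (f ▷ Y) = ((p ≫ F.map f) ⊗ₘ q) ≫ μ F X' Y := by
  rw [← μ_natural_left, MonoidalCategory.tensorHom_def', MonoidalCategory.tensorHom_def',
    comp_whiskerRight, Category.assoc, Category.assoc, Category.assoc]

omit [F.Monoidal] in
lemma tensorHom_μ_map_whiskerLeft (F : B ⥤ C) [F.LaxMonoidal] {P Q : C} {X Y Y' : B}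
    (p : P ⟶ F.obj X) (q : Q ⟶ F.obj Y) (g : Y ⟶ Y') :
    (p ⊗ₘ q) ≫ μ F X Y ≫ F.map (X ◁ g) = (p ⊗ₘ (q ≫ F.map g)) ≫ μ F X Y' := by
  rw [← μ_natural_right, MonoidalCategory.tensorHom_def, MonoidalCategory.tensorHom_def,
    whiskerLeft_comp, Category.assoc, Category.assoc, Category.assoc]

omit [F.Monoidal] in
lemma tensorHom_μ_assoc (F : B ⥤ C) [F.LaxMonoidal] {X Y Z : B}
    (p : 𝟙_ C ⟶ F.obj X) (q : 𝟙_ C ⟶ F.obj Y) (r : 𝟙_ C ⟶ F.obj Z) :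
    (((λ_ (𝟙_ C)).inv ≫ (p ⊗ₘ q) ≫ μ F X Y) ⊗ₘ r) ≫ μ F (X ⊗ Y) Z ≫ F.map (α_ X Y Z).hom =
      (p ⊗ₘ ((λ_ (𝟙_ C)).inv ≫ (q ⊗ₘ r) ≫ μ F Y Z)) ≫ μ F X (Y ⊗ Z) := by
  have h₁ {A A' A'' : C} (a : 𝟙_ C ⟶ A) (b : A ⟶ A') (m : A' ⟶ A'') :
      ((a ≫ b ≫ m) ⊗ₘ r) = a ▷ _ ≫ (b ⊗ₘ r) ≫ m ▷ _ := by
    simp only [MonoidalCategory.tensorHom_def', comp_whiskerRight, Category.assoc,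
      whisker_exchange_assoc]
  have h₂ {A A' A'' : C} (a : 𝟙_ C ⟶ A) (b : A ⟶ A') (m : A' ⟶ A'') :
      (p ⊗ₘ (a ≫ b ≫ m)) = _ ◁ a ≫ (p ⊗ₘ b) ≫ _ ◁ m := by
    simp only [MonoidalCategory.tensorHom_def, whiskerLeft_comp, Category.assoc,
      whisker_exchange_assoc]
  have h₃ : (λ_ (𝟙_ C)).inv ▷ 𝟙_ C ≫ (α_ _ _ _).hom = 𝟙_ C ◁ (λ_ (𝟙_ C)).inv := by monoidal
  rw [h₁, h₂]
  simp only [Category.assoc, Functor.LaxMonoidal.associativity]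
  rw [MonoidalCategory.associator_naturality_assoc, reassoc_of% h₃]

/-- The comultiplication of the universal object. -/
noncomputable def comul : U.obj ⟶ U.obj ⊗ U.obj :=
  (U.existsUnique _ ((λ_ (𝟙_ C)).inv ≫ (U.pt ⊗ₘ U.pt) ≫ μ F _ _)).choose

lemma pt_comul : U.pt ≫ F.map U.comul = (λ_ (𝟙_ C)).inv ≫ (U.pt ⊗ₘ U.pt) ≫ μ F _ _ :=
  (U.existsUnique _ _).choose_spec.1

/-- The counit of the universal object. -/
noncomputable def counit : U.obj ⟶ 𝟙_ B := (U.existsUnique _ (ε F)).choose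

lemma pt_counit : U.pt ≫ F.map U.counit = ε F :=
  (U.existsUnique _ _).choose_spec.1

/-- The universal object is a comonoid. -/
noncomputable abbrev comonObj : ComonObj U.obj where
  counit := U.counit
  comul := U.comul
  counit_comul := by
    apply U.hom_ext
    rw [F.map_comp, reassoc_of% @pt_comul, MonoidalCategory.tensorHom_def', Category.assoc,
      ← μ_natural_left, ← comp_whiskerRight_assoc, pt_counit, map_leftUnitor_inv,
      leftUnitor_inv_naturality_assoc]
  comul_counit := by
    apply U.hom_ext
    rw [F.map_comp, reassoc_of% @pt_comul, MonoidalCategory.tensorHom_def, Category.assoc,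
      ← μ_natural_right, ← whiskerLeft_comp_assoc, pt_counit, map_rightUnitor_inv,
      rightUnitor_inv_naturality_assoc, unitors_inv_equal]
  comul_assoc := by
    apply U.hom_ext
    rw [F.map_comp, F.map_comp, F.map_comp, reassoc_of% @pt_comul, reassoc_of% @pt_comul,
      reassoc_of% @tensorHom_μ_map_whiskerRight, tensorHom_μ_map_whiskerLeft, pt_comul]
    exact congrArg _ (tensorHom_μ_assoc F U.pt U.pt U.pt).symm

end Comonoid

variable {ι : C ⥤ B} (θ : ι ⋙ F ≅ 𝟭 C)

/-- The tensor product with an object of `C`, after applying `F`. -/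
def tensorFiberIso (X : B) (Y : C) : F.obj X ⊗ Y ≅ F.obj (X ⊗ ι.obj Y) :=
  whiskerLeftIso (F.obj X) (fiberIso θ Y).symm ≪≫ μIso F X (ι.obj Y)

lemma tensorFiberIso_hom (X : B) (Y : C) :
    (tensorFiberIso θ X Y).hom = F.obj X ◁ (fiberIso θ Y).inv ≫ μ F X (ι.obj Y) := rfl

lemma tensorFiberIso_naturality_right (X : B) {Y Y' : C} (g : Y ⟶ Y') :
    F.obj X ◁ g ≫ (tensorFiberIso θ X Y').hom =
      (tensorFiberIso θ X Y).hom ≫ F.map (X ◁ ι.map g) := by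
  simp only [tensorFiberIso_hom, Category.assoc]
  rw [← μ_natural_right, ← whiskerLeft_comp_assoc, ← whiskerLeft_comp_assoc, fiberIso_inv_map]

variable [RightRigidCategory B]

/-- The universal morphism `U ⊗ ι (F X) ⟶ X`. -/
noncomputable def ev (X : B) : U.obj ⊗ ι.obj (F.obj X) ⟶ X := U.desc (fiberIso θ (F.obj X)).hom

/-- The action of `F U` on `F X`. -/
noncomputable def act (X : B) : F.obj U.obj ⊗ F.obj X ⟶ F.obj X :=
  (tensorFiberIso θ U.obj (F.obj X)).hom ≫ F.map (U.ev θ X)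

lemma pt_tensorFiberIso_ev (X : B) :
    U.pt ▷ F.obj X ≫ (tensorFiberIso θ U.obj (F.obj X)).hom ≫ F.map (U.ev θ X) =
      (λ_ (F.obj X)).hom := by
  rw [tensorFiberIso_hom, Category.assoc, ← whisker_exchange_assoc, ev, pt_desc,
    leftUnitor_naturality_assoc]
  simp

lemma pt_act (X : B) : U.pt ▷ F.obj X ≫ U.act θ X = (λ_ (F.obj X)).hom :=
  U.pt_tensorFiberIso_ev θ X

/-- A morphism out of a free object is determined by its restriction to the generators. -/
lemma tensorFiberIso_map {Y : C} {Z : B} (g : U.obj ⊗ ι.obj Y ⟶ Z) {s : Y ⟶ F.obj Z}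
    (hs : U.pt ▷ Y ≫ (tensorFiberIso θ U.obj Y).hom ≫ F.map g = (λ_ Y).hom ≫ s) :
    (tensorFiberIso θ U.obj Y).hom ≫ F.map g = F.obj U.obj ◁ s ≫ U.act θ Z := by
  -- Both maps out of `U ⊗ ι Y` restrict to `s` on the generators `Y`. Later identities between
  -- actions follow the same pattern: write one side as `F` of a map out of a free object (usually
  -- called `e`), then compare at the point.
  have : g = U.obj ◁ ι.map s ≫ U.ev θ Z := by
    apply U.tensor_hom_ext
    rw [← cancel_epi (𝟙_ C ◁ (fiberIso θ Y).inv), whisker_exchange_assoc, whisker_exchange_assoc]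
    simp only [tensorFiberIso_hom, Category.assoc] at hs
    have h := tensorFiberIso_naturality_right θ U.obj s
    rw [tensorFiberIso_hom θ _ Y, Category.assoc] at h
    rw [hs, F.map_comp, ← reassoc_of% h, ← whisker_exchange_assoc, pt_tensorFiberIso_ev,
      leftUnitor_naturality]
  rw [this, F.map_comp, ← reassoc_of% @tensorFiberIso_naturality_right]
  rfl

lemma act_naturality {X X' : B} (f : X ⟶ X') :
    U.act θ X ≫ F.map f = F.obj U.obj ◁ F.map f ≫ U.act θ X' := by
  rw [act, Category.assoc, ← F.map_comp]
  apply U.tensorFiberIso_map θ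
  rw [F.map_comp, reassoc_of% @pt_tensorFiberIso_ev]

variable [ι.Monoidal] [NatTrans.IsMonoidal θ.hom]

/-- `F U` acts on `F (X ⊗ ι Y)` through the action on `F X`. -/
lemma tensorFiberIso_act (X : B) (Y : C) :
    F.obj U.obj ◁ (tensorFiberIso θ X Y).hom ≫ U.act θ (X ⊗ ι.obj Y) =
      (α_ _ _ _).inv ≫ U.act θ X ▷ Y ≫ (tensorFiberIso θ X Y).hom := by
  have e : (tensorFiberIso θ U.obj (F.obj X ⊗ Y)).hom ≫
      F.map (U.obj ◁ δ ι _ _ ≫ (α_ _ _ _).inv ≫ U.ev θ X ▷ ι.obj Y) =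
      (α_ _ _ _).inv ≫ U.act θ X ▷ Y ≫ (tensorFiberIso θ X Y).hom := by
    simp only [act, tensorFiberIso_hom, Functor.map_comp, map_whiskerLeft, map_whiskerRight,
      map_associator_inv, Category.assoc, μ_δ_assoc, comp_whiskerRight]
    rw [← whiskerLeft_comp_assoc, ← whiskerLeft_comp_assoc, Category.assoc, fiberIso_inv_tensor,
      MonoidalCategory.tensorHom_def, whiskerLeft_comp_assoc,
      associator_inv_naturality_right_assoc]
    simp only [whisker_exchange_assoc, associator_inv_naturality_middle_assoc]
  rw [← e]
  symm
  apply U.tensorFiberIso_map θ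
  rw [e, associator_inv_naturality_left_assoc, ← comp_whiskerRight_assoc, pt_act]
  monoidal

/-- The action is associative. -/
lemma act_act (X : B) : U.act θ U.obj ▷ F.obj X ≫ U.act θ X =
    (α_ _ _ _).hom ≫ F.obj U.obj ◁ U.act θ X ≫ U.act θ X := by
  -- Associativity is naturality of the action along `ev`, because the action on `F (U ⊗ ι (F X))`
  -- is multiplication on the left factor.
  have h := U.act_naturality θ (U.ev θ X)
  have h' := U.tensorFiberIso_act θ U.obj (F.obj X) =≫ F.map (U.ev θ X)
  rw [Category.assoc, h, ← whiskerLeft_comp_assoc, Category.assoc, Category.assoc] at h'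
  change F.obj U.obj ◁ U.act θ X ≫ U.act θ X = (α_ _ _ _).inv ≫ U.act θ U.obj ▷ F.obj X ≫
    U.act θ X at h'
  rw [h', Iso.hom_inv_id_assoc]

omit [RightRigidCategory B] in
lemma fiberIso_inv_unit : (fiberIso θ (𝟙_ C)).inv = ε F ≫ F.map (ε ι) := by
  rw [← cancel_mono (fiberIso θ (𝟙_ C)).hom, Category.assoc, unit_fiberIso_hom, Iso.inv_hom_id]

lemma pt_act_right : F.obj U.obj ◁ U.pt ≫ U.act θ U.obj = (ρ_ (F.obj U.obj)).hom := by
  have e : (tensorFiberIso θ U.obj (𝟙_ C)).hom ≫ F.map (U.obj ◁ η ι ≫ (ρ_ U.obj).hom) =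
      (ρ_ (F.obj U.obj)).hom := by
    rw [tensorFiberIso_hom, fiberIso_inv_unit, F.map_comp, Category.assoc,
      ← μ_natural_right_assoc, ← whiskerLeft_comp_assoc, Category.assoc, map_ε_η,
      Category.comp_id, map_rightUnitor, μ_δ_assoc, whiskerLeft_ε_η_assoc]
  rw [← e]
  symm
  apply U.tensorFiberIso_map θ
  rw [e, rightUnitor_naturality, unitors_equal]

-- The map `U ⊗ ι (F (ι Y)) ⟶ ι Y` given by the counit and `θ` restricts to the identity on
-- generators, so it induces the action. Hence objects of `C` become trivial modules.
omit [NatTrans.IsMonoidal θ.hom] in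
lemma act_fiber (Y : C) : U.act θ (ι.obj Y) =
    F.map U.counit ▷ F.obj (ι.obj Y) ≫ η F ▷ F.obj (ι.obj Y) ≫ (λ_ (F.obj (ι.obj Y))).hom := by
  have e : (tensorFiberIso θ U.obj (F.obj (ι.obj Y))).hom ≫
      F.map (U.counit ▷ _ ≫ (λ_ _).hom ≫ ι.map (fiberIso θ Y).hom) =
      F.map U.counit ▷ F.obj (ι.obj Y) ≫ η F ▷ F.obj (ι.obj Y) ≫ (λ_ (F.obj (ι.obj Y))).hom := by
    rw [tensorFiberIso_hom, F.map_comp, F.map_comp, Category.assoc, ← μ_natural_left_assoc,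
      map_leftUnitor, Category.assoc, Category.assoc, μ_δ_assoc, whisker_exchange_assoc,
      whisker_exchange_assoc, leftUnitor_naturality_assoc, fiberIso_inv_map, Iso.hom_inv_id,
      Category.comp_id]
  rw [← e]
  symm
  rw [← Category.id_comp (U.act θ _), ← whiskerLeft_id]
  apply U.tensorFiberIso_map θ
  rw [e, ← comp_whiskerRight_assoc, pt_counit]
  simp

omit [NatTrans.IsMonoidal θ.hom] in
lemma act_unit : U.act θ (𝟙_ B) =
    F.map U.counit ▷ F.obj (𝟙_ B) ≫ η F ▷ F.obj (𝟙_ B) ≫ (λ_ (F.obj (𝟙_ B))).hom := by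
  rw [← cancel_mono (F.map (ε ι)), act_naturality, act_fiber, whisker_exchange_assoc,
    whisker_exchange_assoc, leftUnitor_naturality]
  simp only [Category.assoc]

end UniversalPoint

/-! ### Action on tensor products -/

namespace UniversalPoint

open Functor.LaxMonoidal Functor.OplaxMonoidal Functor.Monoidal

section Interchange

variable {C : Type u₁} [Category.{v₁} C] [MonoidalCategory C]
  {B : Type u₂} [Category.{v₂} B] [MonoidalCategory B]

/-- Monoidal functors commute with the exchange of the middle factors of a fourfold tensor
product. -/
lemma μ_map_interchange (F : B ⥤ C) [F.Monoidal] {X Y Z W Y' Z' : B} (f : Y ⊗ Z ⟶ Z' ⊗ Y') :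
    (μ F X Y ⊗ₘ μ F Z W) ≫ μ F (X ⊗ Y) (Z ⊗ W) ≫
      F.map ((α_ X Y (Z ⊗ W)).hom ≫ X ◁ ((α_ Y Z W).inv ≫ f ▷ W ≫ (α_ Z' Y' W).hom) ≫
        (α_ X Z' (Y' ⊗ W)).inv) =
    (α_ _ _ _).hom ≫ F.obj X ◁ ((α_ _ _ _).inv ≫
      (μ F Y Z ≫ F.map f ≫ δ F Z' Y') ▷ F.obj W ≫ (α_ _ _ _).hom) ≫ (α_ _ _ _).inv ≫
        (μ F X Z' ⊗ₘ μ F Y' W) ≫ μ F (X ⊗ Z') (Y' ⊗ W) := by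
  rw [MonoidalCategory.tensorHom_def', MonoidalCategory.tensorHom_def']
  simp only [Functor.map_comp, map_whiskerLeft, map_whiskerRight, map_associator,
    map_associator_inv, Category.assoc, μ_δ_assoc, whiskerLeft_comp, comp_whiskerRight,
    whiskerRight_μ_δ_assoc, whiskerLeft_μ_δ_assoc]
  rw [associator_naturality_right_assoc, ← associator_inv_naturality_right_assoc]
  simp only [← whiskerLeft_comp_assoc]
  simp only [whiskerLeft_comp, Category.assoc, whiskerLeft_μ_δ_assoc]

end Interchange

variable {C : Type u₁} [Category.{v₁} C] [MonoidalCategory C] [BraidedCategory C]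
  {B : Type u₂} [Category.{v₂} B] [MonoidalCategory B]
  {F : B ⥤ C} [F.Monoidal] (U : UniversalPoint F)
  {ι : C ⥤ B} [ι.Monoidal] (θ : ι ⋙ F ≅ 𝟭 C)

/-- A functor `F` which retracts `ι` takes the half-braidings of `c` to the braiding. -/
def MapsToBraiding (c : CentralStructure ι) (θ : ι ⋙ F ≅ 𝟭 C) : Prop :=
  ∀ (X : B) (Y : C), μ F X (ι.obj Y) ≫ F.map (c.iso X Y).hom =
    F.obj X ◁ (fiberIso θ Y).hom ≫ (β_ (F.obj X) Y).hom ≫ (fiberIso θ Y).inv ▷ F.obj X ≫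
      μ F (ι.obj Y) X

/-- The exchange of the middle factors of `(X ⊗ X') ⊗ (ι Y ⊗ ι Y')`. -/
def interchange (c : CentralStructure ι) (X X' : B) (Y Y' : C) :
    (X ⊗ X') ⊗ (ι.obj Y ⊗ ι.obj Y') ⟶ (X ⊗ ι.obj Y) ⊗ (X' ⊗ ι.obj Y') :=
  (α_ X X' (ι.obj Y ⊗ ι.obj Y')).hom ≫ X ◁ ((α_ X' (ι.obj Y) (ι.obj Y')).inv ≫
    (c.iso X' Y).hom ▷ ι.obj Y' ≫ (α_ (ι.obj Y) X' (ι.obj Y')).hom) ≫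
      (α_ X (ι.obj Y) (X' ⊗ ι.obj Y')).inv

variable {θ}

/-- Here the hypothesis that `F` sends `c` to `β` enters: it turns the exchange by `c` in `B` into
the exchange `tensorμ` by `β` in `C`, as the bialgebra axiom requires. -/
lemma μ_map_interchange_eq {c : CentralStructure ι} (hc : MapsToBraiding c θ) (X X' : B)
    (Y Y' : C) :
    (μ F X X' ⊗ₘ (((fiberIso θ Y).inv ⊗ₘ (fiberIso θ Y').inv) ≫ μ F _ _)) ≫ μ F _ _ ≫
      F.map (interchange c X X' Y Y') =
    tensorμ (F.obj X) (F.obj X') Y Y' ≫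
      ((tensorFiberIso θ X Y).hom ⊗ₘ (tensorFiberIso θ X' Y').hom) ≫ μ F _ _ := by
  have h₁ := hc X' Y =≫ δ F _ _
  simp only [Category.assoc, μ_δ, Category.comp_id] at h₁
  have h₂ : (μ F X X' ⊗ₘ (((fiberIso θ Y).inv ⊗ₘ (fiberIso θ Y').inv) ≫ μ F _ _)) =
    (_ ◁ ((fiberIso θ Y).inv ⊗ₘ (fiberIso θ Y').inv)) ≫
      (μ F X X' ⊗ₘ μ F (ι.obj Y) (ι.obj Y')) := by
    rw [← id_tensorHom, tensorHom_comp_tensorHom, Category.id_comp]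
  have h₃ : ((tensorFiberIso θ X Y).hom ⊗ₘ (tensorFiberIso θ X' Y').hom) =
      (F.obj X ◁ (fiberIso θ Y).inv ⊗ₘ F.obj X' ◁ (fiberIso θ Y').inv) ≫
        (μ F X (ι.obj Y) ⊗ₘ μ F X' (ι.obj Y')) := by
    rw [tensorHom_comp_tensorHom]
    rfl
  have h₄ := tensorμ_natural_right (F.obj X) (F.obj X') (fiberIso θ Y).inv (fiberIso θ Y').inv
  rw [h₂, interchange, Category.assoc, μ_map_interchange, h₁,
    ← BraidedCategory.braiding_naturality_right, whiskerLeft_hom_inv_assoc, h₃, Category.assoc,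
    ← reassoc_of% h₄]
  simp only [tensorμ, Category.assoc, whiskerLeft_comp]

variable (θ) [RightRigidCategory B] [NatTrans.IsMonoidal θ.hom]

/-- The comultiplication on the image of the universal object. -/
noncomputable def fiberComul : F.obj U.obj ⟶ F.obj U.obj ⊗ F.obj U.obj := F.map U.comul ≫ δ F _ _

omit [BraidedCategory C] [RightRigidCategory B] in
lemma pt_fiberComul : U.pt ≫ U.fiberComul = (λ_ (𝟙_ C)).inv ≫ (U.pt ⊗ₘ U.pt) := by
  simp [fiberComul, reassoc_of% @pt_comul]

/-- The action on a tensor product is given by the comultiplication. -/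
lemma μ_act {c : CentralStructure ι} (hc : MapsToBraiding c θ) (X X' : B) :
    F.obj U.obj ◁ μ F X X' ≫ U.act θ (X ⊗ X') =
      U.fiberComul ▷ (F.obj X ⊗ F.obj X') ≫ tensorμ _ _ _ _ ≫ (U.act θ X ⊗ₘ U.act θ X') ≫
        μ F X X' := by
  -- The diagonal action lifts to a map in `B` made of `comul`, `c` and two copies of `ev`. By
  -- grouplikeness of the point it restricts to `μ F X X'` on generators, which characterises the
  -- action on `F (X ⊗ X')`.
  have e : (tensorFiberIso θ U.obj (F.obj X ⊗ F.obj X')).hom ≫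
      F.map (U.obj ◁ δ ι _ _ ≫ U.comul ▷ _ ≫ interchange c _ _ _ _ ≫ (U.ev θ X ⊗ₘ U.ev θ X')) =
      U.fiberComul ▷ (F.obj X ⊗ F.obj X') ≫ tensorμ _ _ _ _ ≫ (U.act θ X ⊗ₘ U.act θ X') ≫
        μ F X X' := by
    simp only [act]
    rw [← tensorHom_comp_tensorHom, Category.assoc, μ_natural, ← reassoc_of% (μ_map_interchange_eq hc)]
    have h' {P : C} (s : P ⟶ F.obj (ι.obj (F.obj X) ⊗ ι.obj (F.obj X'))) :
        U.fiberComul ▷ P ≫ (μ F U.obj U.obj ⊗ₘ s) =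
          F.obj U.obj ◁ s ≫ F.map U.comul ▷ F.obj (ι.obj (F.obj X) ⊗ ι.obj (F.obj X')) := by
      rw [← tensorHom_id, tensorHom_comp_tensorHom, fiberComul, Category.assoc, δ_μ,
        Category.comp_id, Category.id_comp, MonoidalCategory.tensorHom_def']
    have h : (fiberIso θ (F.obj X ⊗ F.obj X')).inv ≫ F.map (δ ι (F.obj X) (F.obj X')) =
        ((fiberIso θ (F.obj X)).inv ⊗ₘ (fiberIso θ (F.obj X')).inv) ≫ μ F _ _ := by
      rw [← fiberIso_inv_tensor]
      simp
    rw [reassoc_of% h', μ_natural_left_assoc, ← h, whiskerLeft_comp_assoc,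
      μ_natural_right_assoc, tensorFiberIso_hom, Category.assoc]
    simp only [F.map_comp]
  rw [← e]
  symm
  apply U.tensorFiberIso_map θ
  rw [e, ← comp_whiskerRight_assoc, pt_fiberComul, comp_whiskerRight_assoc,
    tensorμ_natural_left_assoc, tensorHom_comp_tensorHom_assoc, pt_act, pt_act]
  rw [← tensor_left_unitality_assoc]

end UniversalPoint

/-! ### The antipode -/

namespace UniversalPoint

open Functor.LaxMonoidal Functor.OplaxMonoidal Functor.Monoidal

variable {C : Type u₁} [Category.{v₁} C] [MonoidalCategory C]
  {B : Type u₂} [Category.{v₂} B] [MonoidalCategory B]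
  {F : B ⥤ C} [F.Monoidal] (U : UniversalPoint F) {ι : C ⥤ B} (θ : ι ⋙ F ≅ 𝟭 C)
  [RightRigidCategory B]

/-- The universal morphism `U ⊗ X ⟶ ι (F X)`. -/
noncomputable def coev (X : B) : U.obj ⊗ X ⟶ ι.obj (F.obj X) :=
  U.desc (fiberIso θ (F.obj X)).inv

/-- The inverse action of `F U` on `F X`. -/
noncomputable def coact (X : B) : F.obj U.obj ⊗ F.obj X ⟶ F.obj X :=
  μ F U.obj X ≫ F.map (U.coev θ X) ≫ (fiberIso θ (F.obj X)).hom

lemma pt_coact (X : B) : U.pt ▷ F.obj X ≫ U.coact θ X = (λ_ (F.obj X)).hom := by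
  rw [coact, coev, reassoc_of% @pt_desc, Iso.inv_hom_id, Category.comp_id]

lemma coact_naturality {X X' : B} (f : X ⟶ X') :
    U.coact θ X ≫ F.map f = F.obj U.obj ◁ F.map f ≫ U.coact θ X' := by
  have h := congrArg F.map (U.desc_naturality (fiberIso θ (F.obj X)).inv (fiberIso θ (F.obj X')).inv
    f (ι.map (F.map f)) (fiberIso_inv_map θ (F.map f)))
  rw [F.map_comp, F.map_comp] at h
  rw [coact, coact, Category.assoc, Category.assoc, ← map_fiberIso_hom, coev, reassoc_of% h,
    μ_natural_right_assoc]
  rfl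

variable [ι.Monoidal] [NatTrans.IsMonoidal θ.hom]

lemma coev_tensor (X : B) (Y : C) :
    (α_ _ _ _).inv ≫ U.coev θ X ▷ ι.obj Y ≫ μ ι _ _ ≫ ι.map (tensorFiberIso θ X Y).hom =
      U.coev θ (X ⊗ ι.obj Y) := by
  apply U.tensor_hom_ext
  rw [← cancel_epi (𝟙_ C ◁ μ F X (ι.obj Y)), coev, coev, pt_desc, whisker_exchange_assoc]
  simp only [F.map_comp, map_associator_inv, map_whiskerRight, Category.assoc, μ_δ_assoc,
    whiskerLeft_μ_δ_assoc]
  rw [associator_inv_naturality_left_assoc, ← comp_whiskerRight_assoc, ← comp_whiskerRight_assoc,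
    Category.assoc, pt_desc, comp_whiskerRight_assoc]
  have h : (fiberIso θ (F.obj X)).inv ▷ F.obj (ι.obj Y) ≫ μ F _ _ ≫ F.map (μ ι (F.obj X) Y) =
      F.obj X ◁ (fiberIso θ Y).hom ≫ (fiberIso θ (F.obj X ⊗ Y)).inv := by
    rw [← tensor_fiberIso_inv, MonoidalCategory.tensorHom_def', Category.assoc,
      whiskerLeft_hom_inv_assoc]
  rw [reassoc_of% h, fiberIso_inv_map, tensorFiberIso_hom, Category.assoc,
    whiskerLeft_hom_inv_assoc, leftUnitor_naturality_assoc]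
  monoidal

lemma tensorFiberIso_coact (X : B) (Y : C) :
    F.obj U.obj ◁ (tensorFiberIso θ X Y).hom ≫ U.coact θ (X ⊗ ι.obj Y) =
      (α_ _ _ _).inv ≫ U.coact θ X ▷ Y ≫ (tensorFiberIso θ X Y).hom := by
  rw [coact, ← coev_tensor]
  have h : μ F _ _ ≫ F.map (μ ι (F.obj X) Y) ≫ (fiberIso θ (F.obj X ⊗ Y)).hom = _ :=
    tensor_fiberIso_hom θ (F.obj X) Y
  simp only [F.map_comp, Category.assoc, map_fiberIso_hom, map_associator_inv, map_whiskerRight,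
    μ_δ_assoc, reassoc_of% h, tensorFiberIso_hom, coact, comp_whiskerRight]
  rw [← whiskerLeft_comp_assoc, Category.assoc, μ_δ, Category.comp_id,
    associator_inv_naturality_right_assoc, whisker_exchange_assoc, whisker_exchange_assoc,
    MonoidalCategory.tensorHom_def', Category.assoc, whiskerLeft_inv_hom_assoc]

/-- The antipode of the image of the universal object. -/
noncomputable def fiberAntipode : F.obj U.obj ⟶ F.obj U.obj :=
  (ρ_ _).inv ≫ F.obj U.obj ◁ U.pt ≫ U.coact θ U.obj

/-- Naturality of `coact` along `ev` gives `h •' (h' • x) = (h •' h') • x`, where `•` is `act` and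
`•'` is `coact`. Setting `h'` to the unit `pt` shows that `coact` is the action through `h ↦ h •'
pt`, the antipode. -/
lemma coact_eq (X : B) : U.coact θ X = U.fiberAntipode θ ▷ F.obj X ≫ U.act θ X := by
  have h := U.coact_naturality θ (U.ev θ X)
  have h' := U.tensorFiberIso_coact θ U.obj (F.obj X) =≫ F.map (U.ev θ X)
  rw [Category.assoc, h, ← whiskerLeft_comp_assoc, Category.assoc, Category.assoc] at h'
  change F.obj U.obj ◁ U.act θ X ≫ U.coact θ X = (α_ _ _ _).inv ≫ U.coact θ U.obj ▷ F.obj X ≫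
    U.act θ X at h'
  have h'' := F.obj U.obj ◁ ((λ_ _).inv ≫ U.pt ▷ F.obj X) ≫= h'
  rw [← whiskerLeft_comp_assoc, Category.assoc, pt_act, Iso.inv_hom_id, whiskerLeft_id,
    Category.id_comp] at h''
  rw [h'', fiberAntipode]
  simp only [whiskerLeft_comp, comp_whiskerRight, Category.assoc]
  rw [associator_inv_naturality_middle_assoc]
  monoidal

/-- The left antipode axiom before applying `F`: as `pt` is grouplike and `coev` restricts to the
inverse of `fiberIso` at `pt`, both sides take `pt` to the same point. -/
lemma comul_coev : U.comul ≫ U.coev θ U.obj = U.counit ≫ ε ι ≫ ι.map U.pt := by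
  apply U.hom_ext
  rw [F.map_comp, F.map_comp, F.map_comp, reassoc_of% @pt_comul, reassoc_of% @pt_counit,
    ← reassoc_of% fiberIso_inv_unit θ, fiberIso_inv_map, MonoidalCategory.tensorHom_def', coev,
    Category.assoc, pt_desc, leftUnitor_naturality_assoc, Iso.inv_hom_id_assoc]

lemma fiberComul_antipode_left :
    U.fiberComul ≫ U.fiberAntipode θ ▷ _ ≫ U.act θ U.obj = (F.map U.counit ≫ η F) ≫ U.pt := by
  have h : F.map (ε ι) ≫ (fiberIso θ (𝟙_ C)).hom = η F := by
    rw [← cancel_epi (ε F), unit_fiberIso_hom, ε_η]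
  rw [← coact_eq, fiberComul, coact, Category.assoc, δ_μ_assoc, ← F.map_comp_assoc, comul_coev]
  simp only [F.map_comp, Category.assoc, map_fiberIso_hom, reassoc_of% h]

-- Writes the composite of the two actions as the image of a map in `B`, so that it may be tested at
-- the universal point.
omit [ι.Monoidal] [NatTrans.IsMonoidal θ.hom] in
lemma fiberComul_coact (X : B) :
    U.fiberComul ▷ F.obj X ≫ (α_ _ _ _).hom ≫ F.obj U.obj ◁ U.coact θ X ≫ U.act θ X =
      μ F _ _ ≫ F.map (U.comul ▷ X ≫ (α_ _ _ _).hom ≫ U.obj ◁ U.coev θ X ≫ U.ev θ X) := by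
  simp only [F.map_comp, map_whiskerLeft, map_whiskerRight, map_associator, fiberComul, coact, act,
    tensorFiberIso_hom, whiskerLeft_comp, comp_whiskerRight, Category.assoc, μ_δ_assoc,
    whiskerLeft_hom_inv_assoc]

-- At the grouplike point both `coact` and `act` are the identity, as is the counit. This makes
-- `coev` and `ev` convolution inverse and, at `X = U` applied to `pt`, yields the right antipode
-- axiom.
omit [ι.Monoidal] [NatTrans.IsMonoidal θ.hom] in
lemma comul_coev_ev (X : B) :
    U.comul ▷ X ≫ (α_ _ _ _).hom ≫ U.obj ◁ U.coev θ X ≫ U.ev θ X = U.counit ▷ X ≫ (λ_ X).hom := by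
  apply U.tensor_hom_ext
  rw [← fiberComul_coact, F.map_comp, map_leftUnitor, ← μ_natural_left_assoc, μ_δ_assoc,
    ← comp_whiskerRight_assoc, ← comp_whiskerRight_assoc, pt_counit, whiskerRight_ε_η_assoc,
    pt_fiberComul, MonoidalCategory.tensorHom_def]
  simp only [comp_whiskerRight, Category.assoc]
  rw [associator_naturality_middle_assoc, ← whiskerLeft_comp_assoc, pt_coact,
    MonoidalCategory.triangle_assoc, ← comp_whiskerRight_assoc, ← comp_whiskerRight_assoc,
    Category.assoc, rightUnitor_naturality, ← unitors_equal, Iso.inv_hom_id_assoc, pt_act]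

omit [ι.Monoidal] [NatTrans.IsMonoidal θ.hom] in
lemma fiberComul_coact_act (X : B) :
    U.fiberComul ▷ F.obj X ≫ (α_ _ _ _).hom ≫ F.obj U.obj ◁ U.coact θ X ≫ U.act θ X =
      (F.map U.counit ≫ η F) ▷ F.obj X ≫ (λ_ _).hom := by
  rw [fiberComul_coact, comul_coev_ev, F.map_comp, map_leftUnitor, ← μ_natural_left_assoc,
    μ_δ_assoc, comp_whiskerRight_assoc]

omit [ι.Monoidal] [NatTrans.IsMonoidal θ.hom] in
lemma fiberComul_antipode_right :
    U.fiberComul ≫ _ ◁ U.fiberAntipode θ ≫ U.act θ U.obj = (F.map U.counit ≫ η F) ≫ U.pt := by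
  have h := ((ρ_ _).inv ≫ _ ◁ U.pt) ≫= U.fiberComul_coact_act θ U.obj
  simp only [Category.assoc] at h
  rw [whisker_exchange_assoc, whisker_exchange_assoc, leftUnitor_naturality,
    ← rightUnitor_inv_naturality_assoc, ← rightUnitor_inv_naturality_assoc] at h
  have h' : (ρ_ (F.obj U.obj ⊗ F.obj U.obj)).inv ≫ (F.obj U.obj ⊗ F.obj U.obj) ◁ U.pt ≫
      (α_ _ _ _).hom = _ ◁ ((ρ_ _).inv ≫ _ ◁ U.pt) := by
    rw [associator_naturality_right, whiskerLeft_comp, whiskerLeft_rightUnitor_inv, Category.assoc]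
  rw [reassoc_of% h', ← whiskerLeft_comp_assoc, Category.assoc] at h
  rw [fiberAntipode, h, unitors_equal, Iso.inv_hom_id_assoc]

end UniversalPoint

/-! ### The Hopf algebra `F U` and the comparison functor -/

namespace UniversalPoint

open Functor.LaxMonoidal Functor.OplaxMonoidal Functor.Monoidal

section Hopf

variable {C : Type u₁} [Category.{v₁} C] [MonoidalCategory C] [BraidedCategory C]
  {B : Type u₂} [Category.{v₂} B] [MonoidalCategory B]
  {F : B ⥤ C} [F.Monoidal] (U : UniversalPoint F)
  {ι : C ⥤ B} [ι.Monoidal] {θ : ι ⋙ F ≅ 𝟭 C} [NatTrans.IsMonoidal θ.hom]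
  [RightRigidCategory B] {c : CentralStructure ι} (hc : MapsToBraiding c θ)

/-- The image of the universal object is a Hopf algebra. -/
noncomputable abbrev hopfObj : HopfObj (F.obj U.obj) where
  toComonObj := letI := U.comonObj; Functor.obj.instComonObj U.obj F
  one := U.pt
  mul := U.act θ U.obj
  one_mul := U.pt_act θ U.obj
  mul_one := U.pt_act_right θ
  mul_assoc := U.act_act θ U.obj
  mul_comul := by
    -- Multiplicativity of `Δ`: the action is natural along `comul`, and on `F (U ⊗ U)` it is
    -- diagonal by `μ_act`. The counit axiom is likewise naturality along `counit` with `act_unit`.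
    have h := _ ◁ δ F _ _ ≫= U.μ_act θ hc U.obj U.obj =≫ δ F _ _
    simp only [Category.assoc, μ_δ, Category.comp_id, whiskerLeft_δ_μ_assoc] at h
    change U.act θ U.obj ≫ U.fiberComul = (U.fiberComul ⊗ₘ U.fiberComul) ≫ tensorμ _ _ _ _ ≫
      (U.act θ U.obj ⊗ₘ U.act θ U.obj)
    rw [MonoidalCategory.tensorHom_def' U.fiberComul, Category.assoc, fiberComul, whiskerLeft_comp, Category.assoc, reassoc_of% @act_naturality, h]
    rfl
  one_comul := by
    change U.pt ≫ U.fiberComul = _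
    rw [pt_fiberComul]
    rfl
  mul_counit := by
    change U.act θ U.obj ≫ F.map U.counit ≫ η F =
      ((F.map U.counit ≫ η F) ⊗ₘ (F.map U.counit ≫ η F)) ≫ (λ_ _).hom
    rw [reassoc_of% @act_naturality, act_unit, MonoidalCategory.tensorHom_def']
    simp only [Category.assoc, whiskerLeft_comp, comp_whiskerRight]
    rw [← leftUnitor_naturality, ← whisker_exchange_assoc, ← whisker_exchange_assoc]
  one_counit := by
    change U.pt ≫ F.map U.counit ≫ η F = _
    rw [reassoc_of% @pt_counit, ε_η]
  antipode := U.fiberAntipode θ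
  antipode_left := U.fiberComul_antipode_left θ
  antipode_right := U.fiberComul_antipode_right θ

/-- The action of the Hopf algebra on the fiber of an object. -/
noncomputable abbrev modObj (X : B) :
    letI := U.hopfObj hc
    ModObj (F.obj U.obj) (F.obj X) :=
  letI := U.hopfObj hc
  { smul := U.act θ X
    one_smul := U.pt_act θ X
    mul_smul := U.act_act θ X }

/-- The functor which takes an object to its fiber. -/
noncomputable def toMod : letI := U.hopfObj hc; B ⥤ Mod C (F.obj U.obj) :=
  letI := U.hopfObj hc
  { obj := fun X => letI := U.modObj hc X; ⟨F.obj X⟩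
    map := fun {X Y} f =>
      letI := U.modObj hc X
      letI := U.modObj hc Y
      Mod.Hom.mk'' (F.map f) (U.act_naturality θ f)
    map_id := fun X => Mod.hom_ext _ _ (F.map_id X)
    map_comp := fun f g => Mod.hom_ext _ _ (F.map_comp f g) }

noncomputable instance toModMonoidal :
    letI := U.hopfObj hc
    (U.toMod hc).Monoidal :=
  letI := U.hopfObj hc
  Functor.CoreMonoidal.toMonoidal
    { εIso := RepCat.mkIso (M := 𝟙_ _) (N := (U.toMod hc).obj (𝟙_ B)) (εIso F) (by
        change (_ ▷ _ ≫ (λ_ (𝟙_ C)).hom) ≫ ε F = _ ◁ ε F ≫ U.act θ (𝟙_ B)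
        rw [act_unit, whisker_exchange_assoc, whisker_exchange_assoc, leftUnitor_naturality]
        change ((F.map U.counit ≫ η F) ▷ _ ≫ _) ≫ _ = _
        simp)
      μIso := fun X Y => RepCat.mkIso (M := (U.toMod hc).obj X ⊗ (U.toMod hc).obj Y)
        (N := (U.toMod hc).obj (X ⊗ Y)) (μIso F X Y) (by
          change (_ ▷ _ ≫ tensorμ _ _ _ _ ≫ (U.act θ X ⊗ₘ U.act θ Y)) ≫ μ F X Y =
            _ ◁ μ F X Y ≫ U.act θ (X ⊗ Y)
          rw [U.μ_act θ hc]
          simp only [Category.assoc]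
          rfl)
      μIso_hom_natural_left := fun f Z => Mod.hom_ext _ _ (μ_natural_left F f Z)
      μIso_hom_natural_right := fun Z f => Mod.hom_ext _ _ (μ_natural_right F Z f)
      associativity := fun X Y Z => Mod.hom_ext _ _ (Functor.LaxMonoidal.associativity F X Y Z)
      left_unitality := fun X => Mod.hom_ext _ _ (Functor.LaxMonoidal.left_unitality F X)
      right_unitality := fun X => Mod.hom_ext _ _ (Functor.LaxMonoidal.right_unitality F X) }

/-- The composition of the inclusion of `C` with the functor to modules is the inclusion of trivial
modules. -/
noncomputable def toModTriv :
    letI := U.hopfObj hc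
    ι ⋙ U.toMod hc ≅ RepCat.triv (F.obj U.obj) :=
  letI := U.hopfObj hc
  NatIso.ofComponents (fun Y => RepCat.mkIso (M := (U.toMod hc).obj (ι.obj Y))
    (N := (RepCat.triv (F.obj U.obj)).obj Y) (fiberIso θ Y) (by
      change U.act θ (ι.obj Y) ≫ (fiberIso θ Y).hom =
        _ ◁ (fiberIso θ Y).hom ≫ (F.map U.counit ≫ η F) ▷ Y ≫ (λ_ Y).hom
      rw [act_fiber, whisker_exchange_assoc, leftUnitor_naturality]
      simp)) (fun g => Mod.hom_ext _ _ (map_fiberIso_hom θ g))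

instance isMonoidal_toModTriv :
    letI := U.hopfObj hc
    NatTrans.IsMonoidal (U.toModTriv hc).hom :=
  letI := U.hopfObj hc
  { unit := Mod.hom_ext _ _ (NatTrans.IsMonoidal.unit (τ := θ.hom))
    tensor := fun X Y => Mod.hom_ext _ _ (NatTrans.IsMonoidal.tensor (τ := θ.hom) X Y) }

lemma preservesHalfBraidings_toMod :
    letI := U.hopfObj hc
    PreservesHalfBraidings c (RepCat.trivCentral (F.obj U.obj)) (U.toMod hc) (U.toModTriv hc) :=
  letI := U.hopfObj hc
  fun X Y => Mod.hom_ext _ _ (hc X Y)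

end Hopf

end UniversalPoint

/-! ### The comparison functor is an equivalence -/

namespace UniversalPoint

open Functor.LaxMonoidal Functor.OplaxMonoidal Functor.Monoidal Limits

variable {C : Type u₁} [Category.{v₁} C] [Abelian C] [MonoidalCategory C]
  {B : Type u₂} [Category.{v₂} B] [Abelian B] [MonoidalCategory B]
  {F : B ⥤ C} [F.Monoidal] (U : UniversalPoint F) {ι : C ⥤ B} (θ : ι ⋙ F ≅ 𝟭 C)
  [RightRigidCategory B]

/-- Fullness: `F (ev)` is split by the unit of the algebra, so `ev : U ⊗ ι (F X) ⟶ X` is epi by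
faithfulness. A module map `g` induces a map on free objects that kills the kernel of `ev`, hence
descends to `X`. -/
lemma exists_map_eq_of_act_comp_eq [F.Additive] [F.Faithful] {X X' : B} (g : F.obj X ⟶ F.obj X')
    (hg : U.act θ X ≫ g = F.obj U.obj ◁ g ≫ U.act θ X') : ∃ f : X ⟶ X', F.map f = g := by
  have hepi : Epi (F.map (U.ev θ X)) := by
    have h := (λ_ _).inv ≫= U.pt_tensorFiberIso_ev θ X
    rw [Iso.inv_hom_id, ← Category.assoc, ← Category.assoc] at h
    exact epi_of_epi_fac h
  have hepi' : Epi (U.ev θ X) := F.epi_of_epi_map hepi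
  have h : F.map (U.obj ◁ ι.map g ≫ U.ev θ X') = F.map (U.ev θ X) ≫ g := by
    rw [← cancel_epi (tensorFiberIso θ U.obj (F.obj X)).hom, F.map_comp,
      ← reassoc_of% @tensorFiberIso_naturality_right]
    exact hg.symm.trans (Category.assoc _ _ _)
  have h' : kernel.ι (U.ev θ X) ≫ U.obj ◁ ι.map g ≫ U.ev θ X' = 0 := by
    apply F.map_injective
    rw [F.map_comp, h, ← F.map_comp_assoc, kernel.condition, F.map_zero, F.map_zero, zero_comp]
  refine ⟨(Abelian.epiIsCokernelOfKernel _ (kernelIsKernel (U.ev θ X))).desc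
    (CokernelCofork.ofπ _ h'), ?_⟩
  rw [← cancel_epi (F.map (U.ev θ X)), ← h, ← F.map_comp]
  congr 1
  exact (Abelian.epiIsCokernelOfKernel _ (kernelIsKernel (U.ev θ X))).fac _
    WalkingParallelPair.one

variable [MonoidalPreadditive C] [F.Additive] [PreservesFiniteColimits F]
  [ι.Monoidal] [NatTrans.IsMonoidal θ.hom]

/-- Essential surjectivity: a module `M` is a quotient of the free module on `M`, and its kernel is
a quotient of the free module on that kernel. The map `f` between these free modules lives in `B`,
and right exactness gives `F (coker f) ≅ M`. -/
lemma exists_iso_of_action {M : C} (a : F.obj U.obj ⊗ M ⟶ M) (h₁ : U.pt ▷ M ≫ a = (λ_ M).hom)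
    (h₂ : U.act θ U.obj ▷ M ≫ a = (α_ _ _ _).hom ≫ F.obj U.obj ◁ a ≫ a) :
    ∃ (Z : B) (r : M ≅ F.obj Z), a ≫ r.hom = F.obj U.obj ◁ r.hom ≫ U.act θ Z := by
  let p : F.obj (U.obj ⊗ ι.obj M) ⟶ M := (tensorFiberIso θ U.obj M).inv ≫ a
  let s : M ⟶ F.obj (U.obj ⊗ ι.obj M) := (λ_ M).inv ≫ U.pt ▷ M ≫ (tensorFiberIso θ U.obj M).hom
  have hs : s ≫ p = 𝟙 M := by simp [s, p, h₁]
  have hp : U.act θ _ ≫ p = F.obj U.obj ◁ p ≫ a := by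
    rw [← cancel_epi (F.obj U.obj ◁ (tensorFiberIso θ U.obj M).hom), reassoc_of% @tensorFiberIso_act,
      Iso.hom_inv_id_assoc, h₂, ← whiskerLeft_comp_assoc, Iso.hom_inv_id_assoc,
      Iso.inv_hom_id_assoc]
  have : IsSplitEpi p := ⟨⟨s, hs⟩⟩
  have : Epi (F.obj U.obj ◁ p) := inferInstanceAs (Epi ((tensorLeft (F.obj U.obj)).map p))
  let i := kernel.ι p
  let f : U.obj ⊗ ι.obj (kernel p) ⟶ U.obj ⊗ ι.obj M := U.obj ◁ ι.map i ≫ U.ev θ _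
  have hf : (tensorFiberIso θ U.obj (kernel p)).hom ≫ F.map f = F.obj U.obj ◁ i ≫ U.act θ _ := by
    rw [F.map_comp, ← reassoc_of% @tensorFiberIso_naturality_right]
    rfl
  -- The kernel of the module map `p` is stable under the action.
  have hfp : F.map f ≫ p = 0 := by
    rw [← cancel_epi (tensorFiberIso θ U.obj (kernel p)).hom, reassoc_of% hf, hp,
      ← whiskerLeft_comp_assoc, kernel.condition, MonoidalPreadditive.whiskerLeft_zero, zero_comp,
      comp_zero]
  -- Acting by the unit shows that the kernel lies in the image of `F f`.
  have hfi : i ≫ F.map (cokernel.π f) = 0 := by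
    rw [← cancel_epi (λ_ _).hom, ← leftUnitor_naturality_assoc, ← reassoc_of% (U.pt_act θ (U.obj ⊗ ι.obj M)),
      whisker_exchange_assoc, ← reassoc_of% hf, ← F.map_comp, cokernel.condition, F.map_zero,
      comp_zero, comp_zero, comp_zero]
  let hc := isColimitOfHasCokernelOfPreservesColimit F f
  let hk := Abelian.epiIsCokernelOfKernel _ (kernelIsKernel p)
  obtain ⟨q, hq⟩ : ∃ q, F.map (cokernel.π f) ≫ q = p :=
    ⟨hc.desc (CokernelCofork.ofπ p hfp), hc.fac _ WalkingParallelPair.one⟩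
  obtain ⟨r, hr⟩ : ∃ r, p ≫ r = F.map (cokernel.π f) :=
    ⟨hk.desc (CokernelCofork.ofπ _ hfi), hk.fac _ WalkingParallelPair.one⟩
  refine ⟨cokernel f, ⟨r, q, ?_, ?_⟩, ?_⟩
  · rw [← cancel_epi p, reassoc_of% hr, hq, Category.comp_id]
  · rw [← cancel_epi (F.map (cokernel.π f)), reassoc_of% hq, hr, Category.comp_id]
  · change a ≫ r = F.obj U.obj ◁ r ≫ U.act θ _
    rw [← cancel_epi (F.obj U.obj ◁ p), ← reassoc_of% hp, hr, act_naturality, ← hr,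
      whiskerLeft_comp_assoc]

end UniversalPoint

namespace UniversalPoint

open Limits

variable {C : Type u₁} [Category.{v₁} C] [Abelian C] [MonoidalCategory C] [MonoidalPreadditive C]
  [BraidedCategory C]
  {B : Type u₂} [Category.{v₂} B] [Abelian B] [MonoidalCategory B] [RightRigidCategory B]
  {F : B ⥤ C} [F.Monoidal] [F.Additive] [F.Faithful] [PreservesFiniteColimits F]
  (U : UniversalPoint F)
  {ι : C ⥤ B} [ι.Monoidal] {θ : ι ⋙ F ≅ 𝟭 C} [NatTrans.IsMonoidal θ.hom]
  {c : CentralStructure ι} (hc : MapsToBraiding c θ)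

lemma isEquivalence_toMod :
    letI := U.hopfObj hc
    (U.toMod hc).IsEquivalence :=
  letI := U.hopfObj hc
  { faithful := ⟨fun h => F.map_injective (congrArg Mod.Hom.hom h)⟩
    full := ⟨fun {X X'} g => by
      obtain ⟨f, hf⟩ := U.exists_map_eq_of_act_comp_eq θ g.hom (RepCat.act_hom g)
      exact ⟨f, Mod.hom_ext _ _ hf⟩⟩
    essSurj := ⟨fun M => by
      obtain ⟨Z, r, hr⟩ := U.exists_iso_of_action θ (ModObj.smul (M := F.obj U.obj) (X := M.X))
        (ModObj.one_smul (M := F.obj U.obj) M.X) (ModObj.mul_smul (M := F.obj U.obj) M.X)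
      exact ⟨Z, ⟨(RepCat.mkIso (M := M) (N := (U.toMod hc).obj Z) r hr).symm⟩⟩⟩ }

omit [F.Faithful] [PreservesFiniteColimits F] in
lemma additive_toMod :
    letI := U.hopfObj hc
    (U.toMod hc).Additive :=
  letI := U.hopfObj hc
  ⟨fun {_ _ _ _} => Mod.hom_ext _ _ F.map_add⟩

omit [F.Additive] [F.Faithful] [PreservesFiniteColimits F] in
lemma linear_toMod (K : Type w) [Field K] [Linear K C] [MonoidalLinear K C] [Linear K B]
    [F.Linear K] :
    letI := U.hopfObj hc
    (U.toMod hc).Linear K :=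
  letI := U.hopfObj hc
  ⟨fun {_ _} f r => Mod.hom_ext _ _ (F.map_smul r f)⟩

end UniversalPoint

/-! ### Assembly of the equivalence -/

theorem mainTheorem4 (K : Type w) [Field K]
    {C : Type u₁} [Category.{v₁} C] [Abelian C] [Linear K C] [MonoidalCategory C]
    [MonoidalPreadditive C] [MonoidalLinear K C] [RigidCategory C] [BraidedCategory C]
    [IsFiniteLinearCategory K C]
    {B : Type u₂} [Category.{v₂} B] [Abelian B] [Linear K B] [MonoidalCategory B]
    [MonoidalPreadditive B] [MonoidalLinear K B] [RigidCategory B]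
    [IsFiniteLinearCategory K B]
    (ι : C ⥤ B) [ι.Monoidal] [ι.Full] [ι.Faithful] [ι.Additive] [ι.Linear K]
    (c : CentralStructure ι) :
    List.TFAE [
      -- a faithful exact tensor functor `F : B ⥤ C` which is the identity on `C`
      ∃ (F : B ⥤ C) (_ : F.Monoidal),
        F.Additive ∧ F.Linear K ∧ F.Faithful ∧
        Limits.PreservesFiniteLimits F ∧ Limits.PreservesFiniteColimits F ∧
        ∃ θ : ι ⋙ F ≅ 𝟭 C, NatTrans.IsMonoidal θ.hom,
      -- an equivalence `B ≌ Rep(H)(C)` of `K`-linear monoidal categories containing `C`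
      ∃ (H : C) (_ : HopfObj H) (E : B ≌ CategoryTheory.Mod C H) (_ : E.functor.Monoidal),
        E.functor.Additive ∧ E.functor.Linear K ∧
        ∃ θ : ι ⋙ E.functor ≅ RepCat.triv H, NatTrans.IsMonoidal θ.hom,
      -- such an equivalence which moreover preserves the half-braidings with `C`
      ∃ (H : C) (_ : HopfObj H) (E : B ≌ CategoryTheory.Mod C H) (_ : E.functor.Monoidal),
        E.functor.Additive ∧ E.functor.Linear K ∧
        ∃ θ : ι ⋙ E.functor ≅ RepCat.triv H, NatTrans.IsMonoidal θ.hom ∧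
          PreservesHalfBraidings c (RepCat.trivCentral H) E.functor θ]
 := by
  tfae_have 3 → 2
  | ⟨H, i, E, j, h₁, h₂, θ, h₃, _⟩ => ⟨H, i, E, j, h₁, h₂, θ, h₃⟩
  tfae_have 2 → 1
  | ⟨H, _, E, _, _, _, θ, _⟩ => exists_fiberFunctor_of_equivalence K ι H E θ
  tfae_have 1 → 3
  | ⟨F, _, _, _, _, _, _, θ, _⟩ => by
    -- The underlying functor is `F`, so linearity, faithfulness and exactness carry over; only the
    -- monoidal structure is new.
    let F' : B ⥤ C := c.twist θ
    have : F'.Additive := inferInstanceAs F.Additive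
    have : F'.Linear K := inferInstanceAs (F.Linear K)
    have : F'.Faithful := inferInstanceAs F.Faithful
    have : Limits.PreservesFiniteLimits F' := inferInstanceAs (Limits.PreservesFiniteLimits F)
    have : Limits.PreservesFiniteColimits F' := inferInstanceAs (Limits.PreservesFiniteColimits F)
    obtain ⟨P, _, hP⟩ := exists_projective_isSeparator K B
    obtain ⟨U, u, hu⟩ := exists_universal_point K
      (IsFiniteLinearCategory.isArtinianObject (K := K)) (isCoseparator_rightDual hP) F' (𝟙_ C)
      (fun _ => IsFiniteLinearCategory.finite_hom _ _) (IsFiniteLinearCategory.finite_hom _ _)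
    let V : UniversalPoint F' := ⟨U, u, hu⟩
    have hc : UniversalPoint.MapsToBraiding c (c.twistIso θ) := c.twist_map_iso θ
    have := V.isEquivalence_toMod hc
    exact ⟨F'.obj V.obj, V.hopfObj hc, (V.toMod hc).asEquivalence,
      V.toModMonoidal hc, V.additive_toMod hc, V.linear_toMod hc K,
      V.toModTriv hc, V.isMonoidal_toModTriv hc, V.preservesHalfBraidings_toMod hc⟩
  tfae_finish
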